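/- Let $p$ be a prime, let $\mu$ be a Borel probability measure on $\mathbb{Z}_p$ whose reduction modulo $p$ is not concentrated on a single residue class (i.e. $\mu(a+p\mathbb{Z}_p)<1$ for every $a\in\mathbb{Z}_p$), and let $\varepsilon>0$. Then there is a constant $K$, depending only on $p$, $\varepsilon$ and $\mu$, such that the following holds for every integer $n\ge 1$. Let $\xi_0,\dots,\xi_{n-1}$ be independent random variables with values in $\mathbb{Z}_p$, each with law $\mu$, and let $$f(X)=\xi_0+\xi_1X+\dots+\xi_{n-1}X^{n-1}+X^n,\qquad f_0(X)=f(pX).$$ Write $C_{\mathbb{Q}_p}(f)=\#\{x\in\mathbb{Q}_p : f(x)=0\}$ and $C_{\mathbb{Z}_p}(f_0)=\#\{x\in\mathbb{Z}_p : f_0(x)=0\}$ for the numbers of roots counted without multiplicity. Then both are integrable random variables, and $$\left|\,\mathbb{E}\big[C_{\mathbb{Q}_p}(f)\big]-\mathbb{E}\big[C_{\mathbb{Z}_p}(f_0)\big]-\frac{p-1}{p+1}\,\right|\le K\,n^{-1/4+\varepsilon}.$$ That is, $\mathbb{E}[C_{\mathbb{Q}_p}(f)]=\mathbb{E}[C_{\mathbb{Z}_p}(f_0)]+\frac{p-1}{p+1}+O(n^{-1/4+\varepsilon})$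 as $n\to\infty$, with an implied constant depending only on $p$, $\varepsilon$ and the law of the $\xi_i$. -/

import Mathlib

open MeasureTheory ProbabilityTheory Polynomial

/-- The monic polynomial `c₀ + c₁ X + ⋯ + cₙ₋₁ Xⁿ⁻¹ + Xⁿ` with non-leading coefficients `c`. -/
noncomputable def monicPoly {R : Type*} [CommRing R] {n : ℕ} (c : Fin n → R) : R[X] :=
  (∑ i : Fin n, C (c i) * X ^ (i : ℕ)) + X ^ n

/-- The number of roots in `A`, counted without multiplicity, of a polynomial `f` with
coefficients in `R`, i.e. the cardinality of `{x ∈ A : f(x) = 0}`. It is used below with `f ≠ 0`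
and `A` a domain of characteristic zero containing `R`, so that this set is finite. -/
noncomputable def rootCount {R : Type*} [CommRing R] (A : Type*) [CommRing A] [Algebra R A]
    (f : R[X]) : ℕ :=
  {x : A | aeval x f = 0}.ncard

/-!
Roots of the monic polynomial `f` in `ℚ_[p]` lie in `ℤ_[p]`, and the roots of `f(pX)` in `ℤ_[p]`
correspond to the non-unit roots of `f`. So the claim is that the expected number of *unit* roots
is `(p - 1) / (p + 1) + O(n ^ (-1/4 + ε))`.

By Hensel's lemma the unit roots `x` at which `f'(x)` has valuation exactly `l` correspond to the
unit classes `a` modulo `p ^ (l + 1)` such that `p ^ (2l + 1) ∣ f(a)` and `p ^ l ∥ f'(a)`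
(`ncard_unitRoots_valuation_eq`). If the pair `(f(a), f'(a))` were uniformly distributed, the
expected number of such classes would be `(p - 1) p ^ l · p ^ (-2l - 1) (p ^ (-l) - p ^ (-l - 1))`,
and these numbers add up to `(p - 1) / (p + 1)` (`sum_expected_roots`).

The pair `(f(a), f'(a))` is a sum of independent vectors `ξ i • (a ^ i, i a ^ (i - 1))`. A nontrivial
character of `(ℤ / p ^ k)²` is nontrivial on at least one of any two consecutive vectors, and since
`μ` is not concentrated on one class modulo `p`, the mean of a nontrivial character of `ℤ / p ^ k`
at `ξ i` is at most `exp (-γ / p ^ (2k))` in absolute value (`exists_norm_integral_char_le`). Hence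
the pair is equidistributed modulo `p ^ k` up to `exp (-γ ⌊n / 2⌋ / p ^ (2k))`
(`abs_prob_pow_dvd_sub_le`).

This handles the roots with `l < s`. A unit root at which `p ^ s ∣ f'` forces the same kind of
congruence at a class modulo `p ^ (s + 1)`, an event of probability about `p ^ (-2s)`. On it there
are at most `p d` roots unless `f mod p` is divisible by some `(X - r) ^ d`. The latter has
probability at most `α ^ d` with `α < 1`, because the coefficients of index at least `d` determine
the first `d` modulo `p` (`prob_pow_dvd_map_le`). Taking `p ^ s` of order `n ^ (1/5)` and `d` of
order `s` makes all errors `O(s p ^ (-2s))`, which is `O(n ^ (-1/4))` (`exists_error_bound`).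
-/

/-! ### Roots of polynomials over the `p`-adic integers -/

section

variable {p : ℕ} [Fact p.Prime]

lemma PadicInt.pow_dvd_iff_norm_le {x : ℤ_[p]} {k : ℕ} :
    (p : ℤ_[p]) ^ k ∣ x ↔ ‖x‖ ≤ (p : ℝ) ^ (-(k : ℤ)) := by
  rw [PadicInt.norm_le_pow_iff_mem_span_pow, Ideal.mem_span_singleton]

lemma PadicInt.isUnit_iff_not_dvd {x : ℤ_[p]} : IsUnit x ↔ ¬ (p : ℤ_[p]) ∣ x := by
  rw [← PadicInt.norm_lt_one_iff_dvd, ← PadicInt.not_isUnit_iff, not_not]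

lemma PadicInt.pow_dvd_sub_appr (x : ℤ_[p]) (k : ℕ) : (p : ℤ_[p]) ^ k ∣ x - (x.appr k : ℤ_[p]) :=
  Ideal.mem_span_singleton.1 (PadicInt.appr_spec k x)

lemma PadicInt.natCast_eq_of_pow_dvd_sub {a b k : ℕ} (ha : a < p ^ k) (hb : b < p ^ k)
    (h : (p : ℤ_[p]) ^ k ∣ (a : ℤ_[p]) - b) : a = b := by
  have h1 : ((p : ℤ_[p]) ^ k ∣ (((a : ℤ) - (b : ℤ) : ℤ) : ℤ_[p])) := by push_cast; exact h
  rw [PadicInt.pow_p_dvd_int_iff] at h1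
  have h2 : b ≡ a [MOD p ^ k] := by
    rw [Nat.modEq_iff_dvd]; push_cast; exact h1
  exact (h2.eq_of_lt_of_lt hb ha).symm

lemma PadicInt.isUnit_natCast_iff {a : ℕ} : IsUnit (a : ℤ_[p]) ↔ ¬ p ∣ a := by
  rw [PadicInt.isUnit_iff_not_dvd, ← PadicInt.norm_lt_one_iff_dvd,
    PadicInt.norm_natCast_lt_one_iff]

lemma PadicInt.isUnit_congr {x y : ℤ_[p]} {k : ℕ} (h : (p : ℤ_[p]) ^ (k + 1) ∣ x - y) :
    IsUnit x ↔ IsUnit y := by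
  rw [PadicInt.isUnit_iff_not_dvd, PadicInt.isUnit_iff_not_dvd, not_iff_not]
  exact (dvd_iff_dvd_of_dvd_sub ((dvd_pow_self _ k.succ_ne_zero).trans h))

lemma pow_dvd_eval_congr {k m : ℕ} (hm : m ≤ k) (g : ℤ_[p][X]) {x y : ℤ_[p]}
    (h : (p : ℤ_[p]) ^ k ∣ x - y) : (p : ℤ_[p]) ^ m ∣ g.eval x ↔ (p : ℤ_[p]) ^ m ∣ g.eval y :=
  dvd_iff_dvd_of_dvd_sub (((pow_dvd_pow _ hm).trans h).trans (Polynomial.sub_dvd_eval_sub x y g))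

/-- Near a root `x` with `p ^ l ∣ f'(x)`, the polynomial vanishes modulo `p ^ (2 * l + 1)`. -/
lemma pow_dvd_eval_of_root {f : ℤ_[p][X]} {x y : ℤ_[p]} {l : ℕ} (hx : f.eval x = 0)
    (hl : (p : ℤ_[p]) ^ l ∣ (derivative f).eval x) (h : (p : ℤ_[p]) ^ (l + 1) ∣ x - y) :
    (p : ℤ_[p]) ^ (2 * l + 1) ∣ f.eval y := by
  obtain ⟨k, hk⟩ := binomExpansion f x (y - x)
  rw [add_sub_cancel, hx, zero_add] at hk
  rw [hk]
  have h' : (p : ℤ_[p]) ^ (l + 1) ∣ y - x := (dvd_sub_comm).1 h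
  apply dvd_add
  · have := mul_dvd_mul hl h'
    rwa [← pow_add, show l + (l + 1) = 2 * l + 1 by ring] at this
  · apply Dvd.dvd.mul_left
    refine dvd_trans ?_ (pow_dvd_pow_of_dvd h' 2)
    rw [← pow_mul]
    exact pow_dvd_pow _ (by omega)

/-- Hensel's lemma turns the count of unit roots at which the derivative has valuation exactly
`l` into a count of residue classes modulo `p ^ (l + 1)`. -/
theorem ncard_unitRoots_valuation_eq (f : ℤ_[p][X]) (l : ℕ) :
    {x : ℤ_[p] | (f.eval x = 0 ∧ IsUnit x) ∧ (p : ℤ_[p]) ^ l ∣ (derivative f).eval x ∧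
        ¬ (p : ℤ_[p]) ^ (l + 1) ∣ (derivative f).eval x}.ncard =
      {a : ℕ | (a < p ^ (l + 1) ∧ ¬ p ∣ a) ∧ (p : ℤ_[p]) ^ (2 * l + 1) ∣ f.eval (a : ℤ_[p]) ∧
        (p : ℤ_[p]) ^ l ∣ (derivative f).eval (a : ℤ_[p]) ∧
        ¬ (p : ℤ_[p]) ^ (l + 1) ∣ (derivative f).eval (a : ℤ_[p])}.ncard := by
  have hp : (1 : ℝ) < p := by exact_mod_cast (Fact.out : p.Prime).one_lt
  refine Set.ncard_congr (fun x _ => x.appr (l + 1)) ?_ ?_ ?_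
  · rintro x ⟨⟨h0, hu⟩, h1, h2⟩
    have hd := PadicInt.pow_dvd_sub_appr x (l + 1)
    refine ⟨⟨PadicInt.appr_lt x _, ?_⟩, pow_dvd_eval_of_root h0 h1 hd, ?_, ?_⟩
    · rw [← PadicInt.isUnit_natCast_iff]
      exact (PadicInt.isUnit_congr hd).1 hu
    · exact (pow_dvd_eval_congr l.le_succ _ hd).1 h1
    · rwa [← pow_dvd_eval_congr le_rfl _ hd]
  · rintro x y ⟨⟨h0, hu⟩, h1, h2⟩ ⟨⟨h0', -⟩, -⟩ hxy
    have hd : (p : ℤ_[p]) ^ (l + 1) ∣ y - x := by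
      have e1 := PadicInt.pow_dvd_sub_appr x (l + 1)
      have e2 := PadicInt.pow_dvd_sub_appr y (l + 1)
      rw [← show x.appr (l + 1) = y.appr (l + 1) from hxy] at e2
      simpa using dvd_sub e2 e1
    obtain ⟨k, hk⟩ := binomExpansion f x (y - x)
    rw [add_sub_cancel, h0, h0', zero_add] at hk
    have hk' : (y - x) * ((derivative f).eval x + k * (y - x)) = 0 := by rw [hk]; ring
    rcases mul_eq_zero.1 hk' with h | h
    · exact (sub_eq_zero.1 h).symm
    · refine absurd ?_ h2
      rw [eq_neg_of_add_eq_zero_left h]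
      exact (hd.mul_left k).neg_right
  · rintro a ⟨⟨ha, hpa⟩, h0, h1, h2⟩
    have hn : ‖(derivative f).eval (a : ℤ_[p])‖ = (p : ℝ) ^ (-(l : ℤ)) := by
      apply le_antisymm (PadicInt.pow_dvd_iff_norm_le.1 h1)
      rw [PadicInt.pow_dvd_iff_norm_le, not_le] at h2
      by_contra! h3
      rw [PadicInt.norm_lt_pow_iff_norm_le_pow_sub_one] at h3
      rw [show (-((l + 1 : ℕ) : ℤ)) = -(l : ℤ) - 1 by push_cast; ring] at h2
      exact absurd h2 (not_lt.2 h3)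
    -- `|f(a)| ≤ p ^ (-2 l - 1) < |f'(a)| ^ 2`
    have hH : ‖aeval (a : ℤ_[p]) f‖ < ‖aeval (a : ℤ_[p]) (derivative f)‖ ^ 2 := by
      rw [coe_aeval_eq_eval, hn]
      refine (PadicInt.pow_dvd_iff_norm_le.1 h0).trans_lt ?_
      rw [← zpow_natCast, ← zpow_mul]
      apply zpow_lt_zpow_right₀ hp
      push_cast; linarith
    obtain ⟨z, hz0, hz1, -, -⟩ := hensels_lemma hH
    rw [coe_aeval_eq_eval] at hz0 hz1
    have hd : (p : ℤ_[p]) ^ (l + 1) ∣ z - a := by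
      rw [PadicInt.pow_dvd_iff_norm_le]
      rw [hn, PadicInt.norm_lt_pow_iff_norm_le_pow_sub_one] at hz1
      rwa [show (-((l + 1 : ℕ) : ℤ)) = -(l : ℤ) - 1 by push_cast; ring]
    refine ⟨z, ⟨⟨hz0, ?_⟩, ?_, ?_⟩, ?_⟩
    · rw [PadicInt.isUnit_congr hd, PadicInt.isUnit_natCast_iff]; exact hpa
    · exact (pow_dvd_eval_congr l.le_succ _ hd).2 h1
    · rwa [pow_dvd_eval_congr le_rfl _ hd]
    · apply PadicInt.natCast_eq_of_pow_dvd_sub (PadicInt.appr_lt z _) ha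
      have := dvd_sub hd (PadicInt.pow_dvd_sub_appr z (l + 1))
      simpa using this

lemma exists_natCast_of_degenerate_root {f : ℤ_[p][X]} {x : ℤ_[p]} {s : ℕ} (hx : f.eval x = 0)
    (hu : IsUnit x) (hs : (p : ℤ_[p]) ^ s ∣ (derivative f).eval x) :
    ∃ a : ℕ, (a < p ^ (s + 1) ∧ ¬ p ∣ a) ∧ (p : ℤ_[p]) ^ (2 * s + 1) ∣ f.eval (a : ℤ_[p]) ∧
        (p : ℤ_[p]) ^ s ∣ (derivative f).eval (a : ℤ_[p]) := by
  have hd := PadicInt.pow_dvd_sub_appr x (s + 1)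
  refine ⟨x.appr (s + 1), ⟨PadicInt.appr_lt x _, ?_⟩, pow_dvd_eval_of_root hx hs hd, ?_⟩
  · rw [← PadicInt.isUnit_natCast_iff]
    exact (PadicInt.isUnit_congr hd).1 hu
  · exact (pow_dvd_eval_congr s.le_succ _ hd).1 hs

lemma finite_setOf_eval_eq_zero {R : Type*} [CommRing R] [IsDomain R] {f : R[X]} (hf : f ≠ 0) :
    {x : R | f.eval x = 0}.Finite := by
  classical
  refine f.roots.toFinset.finite_toSet.subset fun x hx => ?_
  simp [hf, IsRoot.def] at hx ⊢
  exact hx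

/-- Pigeonhole over the residue classes: more than `p * d` roots in `ℤ_[p]` put more than `d` of
them in one class `r`, and the product of the corresponding `X - x` reduces to a power of
`X - r`. -/
lemma exists_pow_dvd_map_of_lt_ncard {f : ℤ_[p][X]} (hf : f ≠ 0) {B : Set ℤ_[p]}
    (hB : ∀ x ∈ B, f.eval x = 0) {d : ℕ} (h : p * d < B.ncard) :
    ∃ r : ZMod p, (X - C r) ^ d ∣ f.map PadicInt.toZMod := by
  classical
  have hfin : B.Finite := (finite_setOf_eval_eq_zero hf).subset hB
  obtain ⟨S, rfl⟩ := hfin.exists_finset_coe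
  rw [Set.ncard_coe_finset] at h
  obtain ⟨r, -, hr⟩ := Finset.exists_lt_card_fiber_of_mul_lt_card_of_maps_to
    (s := S) (t := (Finset.univ : Finset (ZMod p))) (f := fun x => PadicInt.toZMod x) (n := d)
    (fun _ _ => Finset.mem_univ _) (by rwa [Finset.card_univ, ZMod.card])
  refine ⟨r, ?_⟩
  set T := S.filter (fun x => PadicInt.toZMod x = r) with hT
  have h1 : (Multiset.map (fun a => X - C a) T.val).prod ∣ f := by
    rw [Multiset.prod_X_sub_C_dvd_iff_le_roots hf, Multiset.le_iff_subset T.nodup]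
    intro x hx
    rw [mem_roots hf]
    exact hB x (Finset.mem_filter.1 hx).1
  have h2 := Polynomial.map_dvd (PadicInt.toZMod (p := p)) h1
  have h3 : ((Multiset.map (fun a => X - C a) T.val).prod).map PadicInt.toZMod
      = (X - C r) ^ T.card := by
    change (∏ a ∈ T, (X - C a)).map PadicInt.toZMod = _
    rw [Polynomial.map_prod, Finset.prod_eq_pow_card]
    intro x hx
    simp [(Finset.mem_filter.1 hx).2]
  rw [h3] at h2
  exact (pow_dvd_pow _ hr.le).trans h2

section monicPoly

variable {R : Type*} [CommRing R] {n : ℕ}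

lemma monic_monicPoly (c : Fin n → R) : (monicPoly c).Monic := by
  unfold monicPoly
  rw [add_comm]
  exact monic_X_pow_add (degree_sum_fin_lt c)

lemma natDegree_monicPoly [Nontrivial R] (c : Fin n → R) : (monicPoly c).natDegree = n := by
  unfold monicPoly
  rw [add_comm, natDegree_add_eq_left_of_degree_lt, natDegree_X_pow]
  rw [degree_X_pow]
  exact degree_sum_fin_lt c

lemma eval_monicPoly (c : Fin n → R) (x : R) :
    (monicPoly c).eval x = (∑ i : Fin n, c i * x ^ (i : ℕ)) + x ^ n := by
  simp [monicPoly, eval_finsetSum]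

lemma eval_derivative_monicPoly (c : Fin n → R) (x : R) :
    (derivative (monicPoly c)).eval x =
      (∑ i : Fin n, c i * (i * x ^ ((i : ℕ) - 1))) + n * x ^ (n - 1) := by
  simp [monicPoly, eval_finsetSum, derivative_X_pow]

lemma coeff_monicPoly (c : Fin n → R) (i : Fin n) : (monicPoly c).coeff i = c i := by
  simp [monicPoly, coeff_X_pow, Fin.val_inj, i.2.ne]

lemma map_monicPoly {S : Type*} [CommRing S] (φ : R →+* S) (c : Fin n → R) :
    (monicPoly c).map φ = monicPoly fun i => φ (c i) := by
  simp [monicPoly, Polynomial.map_sum]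

end monicPoly

/-- Roots in `ℚ_[p]` of a monic polynomial over `ℤ_[p]` are integral. -/
lemma rootCount_padic_eq {f : ℤ_[p][X]} (hf : f.Monic) :
    rootCount ℚ_[p] f = {x : ℤ_[p] | f.eval x = 0}.ncard := by
  unfold rootCount
  rw [← Set.InjOn.ncard_image ((IsFractionRing.injective ℤ_[p] ℚ_[p]).injOn)]
  congr 1
  ext y
  simp only [Set.mem_ofPred_eq, Set.mem_image]
  constructor
  · intro hy
    obtain ⟨x, rfl⟩ := IsIntegrallyClosed.isIntegral_iff.1 (⟨f, hf, hy⟩ : IsIntegral ℤ_[p] y)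
    refine ⟨x, ?_, rfl⟩
    rw [aeval_algebraMap_apply, coe_aeval_eq_eval] at hy
    exact (FaithfulSMul.algebraMap_eq_zero_iff ℤ_[p] ℚ_[p]).1 hy
  · rintro ⟨x, hx, rfl⟩
    rw [aeval_algebraMap_apply, coe_aeval_eq_eval, hx, map_zero]

lemma rootCount_comp_eq (f : ℤ_[p][X]) :
    rootCount ℤ_[p] (f.comp (C (p : ℤ_[p]) * X)) =
      {x : ℤ_[p] | f.eval x = 0 ∧ ¬ IsUnit x}.ncard := by
  unfold rootCount
  have hp : (p : ℤ_[p]) ≠ 0 := PadicInt.prime_p.ne_zero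
  rw [← Set.InjOn.ncard_image (f := fun x => (p : ℤ_[p]) * x) ((mul_right_injective₀ hp).injOn)]
  congr 1
  ext y
  simp only [Set.mem_ofPred_eq, Set.mem_image, PadicInt.isUnit_iff_not_dvd, not_not,
    coe_aeval_eq_eval, eval_comp, eval_mul, eval_C, eval_X]
  constructor
  · rintro ⟨x, hx, rfl⟩
    exact ⟨hx, dvd_mul_right _ _⟩
  · rintro ⟨hy, x, rfl⟩
    exact ⟨x, hy, rfl⟩

lemma rootCount_padic_eq_add {f : ℤ_[p][X]} (hf : f.Monic) :
    rootCount ℚ_[p] f = rootCount ℤ_[p] (f.comp (C (p : ℤ_[p]) * X)) +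
      {x : ℤ_[p] | f.eval x = 0 ∧ IsUnit x}.ncard := by
  have hfin := finite_setOf_eval_eq_zero hf.ne_zero
  rw [rootCount_padic_eq hf, rootCount_comp_eq, ← Set.ncard_union_eq ?_ (hfin.subset fun x hx => hx.1)
    (hfin.subset fun x hx => hx.1)]
  · congr 1
    ext x
    simp only [Set.mem_ofPred_eq, Set.mem_union]
    tauto
  · rw [Set.disjoint_left]
    rintro x ⟨_, h⟩ ⟨_, h'⟩
    exact h h'

lemma ncard_le_natDegree_of_eval_eq_zero {f : ℤ_[p][X]} (hf : f ≠ 0) {B : Set ℤ_[p]}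
    (hB : ∀ x ∈ B, f.eval x = 0) : B.ncard ≤ f.natDegree := by
  classical
  calc B.ncard ≤ (f.roots.toFinset : Set ℤ_[p]).ncard := by
        refine Set.ncard_le_ncard (fun x hx => ?_) (Finset.finite_toSet _)
        simpa [hf] using hB x hx
    _ ≤ f.natDegree := by
        rw [Set.ncard_coe_finset]
        exact (Multiset.toFinset_card_le _).trans (card_roots' f)

end

/-! ### Characters of the `p`-adic integers -/

section

/-- A nontrivial `q`-th root of unity stays at distance at least `1 / q` from `1`; this is the
resulting bound on its real part. -/
lemma re_le_of_pow_eq_one {ζ : ℂ} {q : ℕ} (hq : q ≠ 0) (h : ζ ^ q = 1) (h1 : ζ ≠ 1) :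
    ζ.re ≤ 1 - 1 / (2 * (q : ℝ) ^ 2) := by
  have hn : ‖ζ‖ = 1 := Complex.norm_eq_one_of_pow_eq_one h hq
  have hq0 : (0 : ℝ) < q := by positivity
  -- `∑ ζ ^ j = 0` over `j < q`, so `q = ∑ (1 - ζ ^ j)`, and each `|1 - ζ ^ j|` is at most
  -- `q |1 - ζ|`
  have hj : ∀ j ∈ Finset.range q, ‖1 - ζ ^ j‖ ≤ q * ‖1 - ζ‖ := by
    intro j hj
    rw [norm_sub_rev, ← geom_sum_mul, norm_mul, norm_sub_rev 1 ζ]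
    refine mul_le_mul_of_nonneg_right ?_ (norm_nonneg _)
    calc ‖∑ i ∈ Finset.range j, ζ ^ i‖ ≤ ∑ i ∈ Finset.range j, ‖ζ ^ i‖ := norm_sum_le _ _
      _ = j := by simp [hn]
      _ ≤ q := by exact_mod_cast (Finset.mem_range.1 hj).le
  have hs : ∑ j ∈ Finset.range q, (1 - ζ ^ j) = q := by
    rw [Finset.sum_sub_distrib, geom_sum_eq h1, h]
    simp
  have h2 : (q : ℝ) ≤ q * (q * ‖1 - ζ‖) := by
    calc (q : ℝ) = ‖∑ j ∈ Finset.range q, (1 - ζ ^ j)‖ := by rw [hs]; simp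
      _ ≤ ∑ j ∈ Finset.range q, ‖1 - ζ ^ j‖ := norm_sum_le _ _
      _ ≤ ∑ j ∈ Finset.range q, q * ‖1 - ζ‖ := Finset.sum_le_sum hj
      _ = q * (q * ‖1 - ζ‖) := by simp
  have h3 : 1 ≤ q * ‖1 - ζ‖ := by
    by_contra! h4
    nlinarith
  have h4 : 1 ≤ (q : ℝ) ^ 2 * ‖1 - ζ‖ ^ 2 := by
    rw [← mul_pow]; exact one_le_pow₀ h3
  have h5 : ‖1 - ζ‖ ^ 2 = 2 - 2 * ζ.re := by
    have e1 : ζ.re * ζ.re + ζ.im * ζ.im = 1 := by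
      rw [← Complex.normSq_apply, ← Complex.sq_norm, hn]; norm_num
    rw [Complex.sq_norm, Complex.normSq_apply]
    simp only [Complex.sub_re, Complex.one_re, Complex.sub_im, Complex.one_im]
    linarith
  rw [h5] at h4
  have h6 : 1 / (2 * (q : ℝ) ^ 2) ≤ 1 - ζ.re := by
    rw [div_le_iff₀ (by positivity)]
    linarith
  linarith

lemma prod_range_le_pow_half {b : ℕ → ℝ} {e : ℝ} (he : 0 ≤ e) (h0 : ∀ i, 0 ≤ b i)
    (h1 : ∀ i, b i ≤ 1) (h2 : ∀ i, b i ≤ e ∨ b (i + 1) ≤ e) (n : ℕ) :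
    ∏ i ∈ Finset.range n, b i ≤ e ^ (n / 2) := by
  induction n using Nat.twoStepInduction with
  | zero => simp
  | one => simpa using h1 0
  | more n ih _ =>
    rw [Finset.prod_range_succ, Finset.prod_range_succ, mul_assoc,
      show (n + 2) / 2 = n / 2 + 1 by omega, pow_succ]
    refine mul_le_mul ih ?_ (mul_nonneg (h0 _) (h0 _)) (pow_nonneg he _)
    rcases h2 n with h | h
    · exact (mul_le_of_le_one_right (h0 _) (h1 _)).trans h
    · exact (mul_le_of_le_one_left (h0 _) (h1 _)).trans h

variable {p : ℕ} [Fact p.Prime]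


lemma AddChar.pow_eq_one_of_trivial {η : AddChar ℤ_[p] ℂ} {k : ℕ}
    (hη : ∀ z, η ((p : ℤ_[p]) ^ k * z) = 1) (z : ℤ_[p]) : η z ^ (p ^ k) = 1 := by
  rw [← AddChar.map_nsmul_eq_pow, nsmul_eq_mul]
  push_cast
  exact hη z

lemma AddChar.norm_eq_one_of_trivial {η : AddChar ℤ_[p] ℂ} {k : ℕ}
    (hη : ∀ z, η ((p : ℤ_[p]) ^ k * z) = 1) (z : ℤ_[p]) : ‖η z‖ = 1 :=
  Complex.norm_eq_one_of_pow_eq_one (AddChar.pow_eq_one_of_trivial hη z)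
    (pow_ne_zero _ (Fact.out : p.Prime).ne_zero)

/-- The kernel of a locally constant character of `ℤ_[p]` is an ideal, so it contains a unit only if
the character is trivial. -/
lemma AddChar.eq_one_of_unit {η : AddChar ℤ_[p] ℂ} {k : ℕ}
    (hη : ∀ z, η ((p : ℤ_[p]) ^ k * z) = 1) {h : ℤ_[p]} (hh : IsUnit h) (h1 : η h = 1)
    (z : ℤ_[p]) : η z = 1 := by
  obtain ⟨c, hc⟩ := hh.dvd (a := z)
  obtain ⟨e, he⟩ := PadicInt.pow_dvd_sub_appr c k
  have hz : z = c.appr k • h + (p : ℤ_[p]) ^ k * (e * h) := by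
    rw [nsmul_eq_mul, ← mul_assoc, ← he, hc]; ring
  rw [hz, AddChar.map_add_eq_mul, AddChar.map_nsmul_eq_pow, h1, hη, one_pow, one_mul]

lemma AddChar.continuous_of_trivial {η : AddChar ℤ_[p] ℂ} {k : ℕ}
    (hη : ∀ z, η ((p : ℤ_[p]) ^ k * z) = 1) : Continuous η := by
  refine IsLocallyConstant.continuous ((IsLocallyConstant.iff_eventually_eq _).2 fun x => ?_)
  have hp : (0 : ℝ) < p := by exact_mod_cast (Fact.out : p.Prime).pos
  filter_upwards [Metric.closedBall_mem_nhds x (zpow_pos hp (-(k : ℤ)))] with y hy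
  rw [mem_closedBall_iff_norm, ← PadicInt.pow_dvd_iff_norm_le] at hy
  obtain ⟨c, hc⟩ := hy
  rw [sub_eq_iff_eq_add.1 hc, AddChar.map_add_eq_mul, hη, one_mul]

lemma PadicInt.toZMod_eq_iff {x y : ℤ_[p]} :
    PadicInt.toZMod x = PadicInt.toZMod y ↔ ¬ IsUnit (x - y) := by
  rw [← sub_eq_zero, ← map_sub, ← RingHom.mem_ker, PadicInt.ker_toZMod,
    IsLocalRing.mem_maximalIdeal, mem_nonunits_iff]

variable [MeasurableSpace ℤ_[p]] [BorelSpace ℤ_[p]]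

lemma measurableSet_isUnit : MeasurableSet {x : ℤ_[p] | IsUnit x} := by
  simp only [PadicInt.isUnit_iff]
  exact (isClosed_eq continuous_norm continuous_const).measurableSet

lemma measurableSet_pow_dvd (k : ℕ) : MeasurableSet {x : ℤ_[p] | (p : ℤ_[p]) ^ k ∣ x} := by
  simp only [PadicInt.pow_dvd_iff_norm_le]
  exact (isClosed_le continuous_norm continuous_const).measurableSet

/-- Two independent samples of `μ` are incongruent modulo `p` with positive probability. -/
lemma real_isUnit_sub_pos {μ : Measure ℤ_[p]} [IsProbabilityMeasure μ]
    (hμ : ∀ a : ZMod p, ¬ ∀ᵐ x ∂μ, PadicInt.toZMod x = a) :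
    0 < (μ.prod μ).real {z | IsUnit (z.1 - z.2)} := by
  by_contra! h
  have h0 : (μ.prod μ) {z | IsUnit (z.1 - z.2)} = 0 := by
    rw [← measureReal_eq_zero_iff]
    exact le_antisymm h measureReal_nonneg
  have h1 : ∀ᵐ z ∂(μ.prod μ), ¬ IsUnit (z.1 - z.2) := by
    rw [ae_iff]; simpa using h0
  obtain ⟨x, hx⟩ := (Measure.ae_ae_of_ae_prod h1).exists
  apply hμ (PadicInt.toZMod x)
  filter_upwards [hx] with y hy
  exact (PadicInt.toZMod_eq_iff.2 hy).symm

/-- The square of `‖∫ η dμ‖` is the mean of `Re η(x - y)` over independent `x, y` of law `μ`. With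
positive probability `x - y` is a unit, and then `η(x - y)` is a `p ^ k`-th root of unity other
than `1`. -/
lemma exists_norm_integral_char_le (μ : Measure ℤ_[p]) [IsProbabilityMeasure μ]
    (hμ : ∀ a : ZMod p, ¬ ∀ᵐ x ∂μ, PadicInt.toZMod x = a) :
    ∃ γ : ℝ, 0 < γ ∧ ∀ (η : AddChar ℤ_[p] ℂ) (k : ℕ), (∀ z, η ((p : ℤ_[p]) ^ k * z) = 1) →
      (∃ z, η z ≠ 1) → ‖∫ z, η z ∂μ‖ ≤ Real.exp (-γ / (p : ℝ) ^ (2 * k)) := by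
  set g := (μ.prod μ).real {z | IsUnit (z.1 - z.2)} with hg
  have hg0 : 0 < g := real_isUnit_sub_pos hμ
  refine ⟨g / 4, by positivity, fun η k hη hne => ?_⟩
  set q : ℕ := p ^ k with hq
  have hq0 : q ≠ 0 := pow_ne_zero _ (Fact.out : p.Prime).ne_zero
  have hcont := AddChar.continuous_of_trivial hη
  have hnorm := AddChar.norm_eq_one_of_trivial hη
  have hmeas : MeasurableSet {z : ℤ_[p] × ℤ_[p] | IsUnit (z.1 - z.2)} :=
    measurableSet_isUnit.preimage (measurable_fst.sub measurable_snd)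
  have hint : Integrable (fun z : ℤ_[p] × ℤ_[p] => η (z.1 - z.2)) (μ.prod μ) := by
    refine Integrable.of_bound (hcont.comp (continuous_fst.sub
      continuous_snd)).measurable.aestronglyMeasurable 1 (ae_of_all _ fun z => ?_)
    exact (hnorm _).le
  have hsq : ‖∫ z, η z ∂μ‖ ^ 2 = ∫ z, (η (z.1 - z.2)).re ∂(μ.prod μ) := by
    have h1 : ((‖∫ z, η z ∂μ‖ ^ 2 : ℝ) : ℂ) = ∫ z, η (z.1 - z.2) ∂(μ.prod μ) := by
      push_cast
      rw [← Complex.mul_conj', ← integral_conj, ← integral_prod_mul]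
      congr 1
      ext z
      rw [sub_eq_add_neg, AddChar.map_add_eq_mul, AddChar.map_neg_eq_inv,
        Complex.inv_eq_conj (hnorm _)]
    have h2 := congrArg Complex.re h1
    rw [Complex.ofReal_re] at h2
    rw [h2]
    exact (integral_re hint).symm
  have hle : ‖∫ z, η z ∂μ‖ ^ 2 ≤ 1 - g / (2 * (q : ℝ) ^ 2) := by
    have h1 : ∫ z, (η (z.1 - z.2)).re ∂(μ.prod μ) ≤ ∫ z, (1 - {z : ℤ_[p] × ℤ_[p] |
        IsUnit (z.1 - z.2)}.indicator (fun _ => 1 / (2 * (q : ℝ) ^ 2)) z) ∂(μ.prod μ) := by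
      refine integral_mono hint.re ((integrable_const _).sub
        ((integrable_const _).indicator hmeas)) fun z => ?_
      by_cases hz : IsUnit (z.1 - z.2)
      · rw [Set.indicator_of_mem (by exact hz)]
        refine re_le_of_pow_eq_one hq0 (AddChar.pow_eq_one_of_trivial hη _) fun h => ?_
        obtain ⟨y, hy⟩ := hne
        exact hy (AddChar.eq_one_of_unit hη hz h y)
      · rw [Set.indicator_of_notMem (by exact hz), sub_zero]
        exact (Complex.re_le_norm _).trans (hnorm _).le
    rw [integral_sub (integrable_const _) ((integrable_const _).indicator hmeas),
      integral_indicator_const _ hmeas, integral_const, probReal_univ, one_smul,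
      smul_eq_mul, ← hsq, ← hg] at h1
    rwa [mul_one_div] at h1
  have hexp : ‖∫ z, η z ∂μ‖ ^ 2 ≤ Real.exp (-(g / 4) / (p : ℝ) ^ (2 * k)) ^ 2 := by
    rw [← Real.exp_nat_mul]
    refine hle.trans ((Real.one_sub_le_exp_neg _).trans (le_of_eq ?_))
    congr 1
    rw [hq, mul_comm 2 k, pow_mul]
    push_cast
    ring
  exact le_of_sq_le_sq hexp (Real.exp_pos _).le

end

/-! ### Equidistribution of `(f(x), f'(x))` and multiplicity modulo `p` -/

section

variable {p : ℕ} [Fact p.Prime]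

/-- The character `(y, z) ↦ e(u y / p ^ a + w z / p ^ b)` of `ℤ_[p] × ℤ_[p]`. -/
noncomputable def pairChar (a b : ℕ) (u : ZMod (p ^ a)) (w : ZMod (p ^ b)) :
    AddChar (ℤ_[p] × ℤ_[p]) ℂ :=
  ((ZMod.stdAddChar.mulShift u).compAddMonoidHom
      ((PadicInt.toZModPow a).toAddMonoidHom.comp (AddMonoidHom.fst _ _))) *
    ((ZMod.stdAddChar.mulShift w).compAddMonoidHom
      ((PadicInt.toZModPow b).toAddMonoidHom.comp (AddMonoidHom.snd _ _)))

lemma pairChar_apply (a b : ℕ) (u : ZMod (p ^ a)) (w : ZMod (p ^ b)) (y z : ℤ_[p]) :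
    pairChar a b u w (y, z) = ZMod.stdAddChar (u * PadicInt.toZModPow a y) *
      ZMod.stdAddChar (w * PadicInt.toZModPow b z) := rfl

lemma PadicInt.toZModPow_eq_zero_iff {k : ℕ} {x : ℤ_[p]} :
    PadicInt.toZModPow k x = 0 ↔ (p : ℤ_[p]) ^ k ∣ x := by
  rw [← RingHom.mem_ker, PadicInt.ker_toZModPow, Ideal.mem_span_singleton]

lemma pairChar_pow_mul {a b k : ℕ} (ha : a ≤ k) (hb : b ≤ k) (u : ZMod (p ^ a))
    (w : ZMod (p ^ b)) (y z : ℤ_[p]) :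
    pairChar a b u w ((p : ℤ_[p]) ^ k * y, (p : ℤ_[p]) ^ k * z) = 1 := by
  rw [pairChar_apply, PadicInt.toZModPow_eq_zero_iff.2 ((pow_dvd_pow _ ha).mul_right y),
    PadicInt.toZModPow_eq_zero_iff.2 ((pow_dvd_pow _ hb).mul_right z)]
  simp

lemma eq_zero_of_pairChar_eq_one {a b : ℕ} {u : ZMod (p ^ a)} {w : ZMod (p ^ b)}
    (h : ∀ y z, pairChar a b u w (y, z) = 1) : u = 0 ∧ w = 0 := by
  constructor
  · apply ZMod.injective_stdAddChar
    simpa [pairChar_apply] using h 1 0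
  · apply ZMod.injective_stdAddChar
    simpa [pairChar_apply] using h 0 1

/-- Fourier expansion of the indicator of `p ^ a ℤ_[p] × p ^ b ℤ_[p]`. -/
lemma sum_pairChar (a b : ℕ) (y z : ℤ_[p]) :
    ∑ u : ZMod (p ^ a), ∑ w : ZMod (p ^ b), pairChar a b u w (y, z) =
      {v : ℤ_[p] × ℤ_[p] | (p : ℤ_[p]) ^ a ∣ v.1 ∧ (p : ℤ_[p]) ^ b ∣ v.2}.indicator
        (fun _ => (p : ℂ) ^ (a + b)) (y, z) := by
  classical
  simp_rw [pairChar_apply, ← Finset.mul_sum, ← Finset.sum_mul]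
  rw [AddChar.sum_mulShift _ (ZMod.isPrimitive_stdAddChar _),
    AddChar.sum_mulShift _ (ZMod.isPrimitive_stdAddChar _)]
  simp only [PadicInt.toZModPow_eq_zero_iff, ZMod.card, Set.indicator_apply, Set.mem_ofPred_eq]
  by_cases h1 : (p : ℤ_[p]) ^ a ∣ y <;> by_cases h2 : (p : ℤ_[p]) ^ b ∣ z <;>
    simp [h1, h2, pow_add]

/-- The restriction of a character of `ℤ_[p] × ℤ_[p]` to the line spanned by `v`. -/
noncomputable def lineChar (χ : AddChar (ℤ_[p] × ℤ_[p]) ℂ) (v : ℤ_[p] × ℤ_[p]) :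
    AddChar ℤ_[p] ℂ :=
  χ.compAddMonoidHom ((AddMonoidHom.mulRight v.1).prod (AddMonoidHom.mulRight v.2))

lemma lineChar_apply (χ : AddChar (ℤ_[p] × ℤ_[p]) ℂ) (v : ℤ_[p] × ℤ_[p]) (h : ℤ_[p]) :
    lineChar χ v h = χ (h * v.1, h * v.2) := rfl

lemma AddChar.map_sum_eq_prod {ι A : Type*} [AddCommMonoid A] (χ : AddChar A ℂ) (s : Finset ι)
    (g : ι → A) : χ (∑ i ∈ s, g i) = ∏ i ∈ s, χ (g i) := by
  classical
  induction s using Finset.induction_on with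
  | empty => simp
  | insert i s hi ih => rw [Finset.sum_insert hi, Finset.prod_insert hi, map_add_eq_mul, ih]

/-- The vectors by which consecutive coefficients move the pair `(f(x), f'(x))` span `ℤ_[p]²` when
`x` is a unit, so a nontrivial character is nontrivial on one of them. -/
lemma lineChar_ne_one_or {χ : AddChar (ℤ_[p] × ℤ_[p]) ℂ} (hχ : ∃ v, χ v ≠ 1) {x : ℤ_[p]}
    (hx : IsUnit x) (i : ℕ) :
    (∃ h, lineChar χ (x ^ i, i * x ^ (i - 1)) h ≠ 1) ∨
      (∃ h, lineChar χ (x ^ (i + 1), (i + 1 : ℕ) * x ^ (i + 1 - 1)) h ≠ 1) := by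
  by_contra! hcon
  obtain ⟨h1, h2⟩ := hcon
  simp only [lineChar_apply] at h1 h2
  have hadd : ∀ y z, χ (y, z) = χ (y, 0) * χ (0, z) := fun y z => by
    rw [← AddChar.map_add_eq_mul]; simp
  have h3 : ∀ h, χ (0, h * x ^ i) = 1 := fun h => by
    have e1 := h1 (h * x)
    have e2 := h2 h
    have e3 : (h * x ^ (i + 1), h * (((i + 1 : ℕ) : ℤ_[p]) * x ^ (i + 1 - 1))) =
        (h * x * x ^ i, h * x * (i * x ^ (i - 1))) + (0, h * x ^ i) := by
      rw [Prod.mk_add_mk]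
      rcases i with _ | i
      · simp
      · simp only [Nat.add_sub_cancel]
        push_cast
        congr 1 <;> ring
    rw [e3, AddChar.map_add_eq_mul, e1, one_mul] at e2
    exact e2
  obtain ⟨c, hc⟩ := (hx.pow i).exists_left_inv
  have h4 : ∀ z, χ (0, z) = 1 := fun z => by
    have := h3 (z * c)
    rwa [mul_assoc, hc, mul_one] at this
  have h5 : ∀ y, χ (y, 0) = 1 := fun y => by
    have := h1 (y * c)
    rwa [hadd, h4, mul_one, mul_assoc, hc, mul_one] at this
  obtain ⟨⟨y, z⟩, hv⟩ := hχ
  exact hv (by rw [hadd, h4, h5, one_mul])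

variable [MeasurableSpace ℤ_[p]] [BorelSpace ℤ_[p]]

lemma measurableSet_toZMod_eq (c : ZMod p) :
    MeasurableSet {x : ℤ_[p] | PadicInt.toZMod x = c} := by
  have e : {x : ℤ_[p] | PadicInt.toZMod x = c} =
      (fun x => x - (c.val : ℤ_[p])) ⁻¹' {x : ℤ_[p] | IsUnit x}ᶜ := by
    ext x
    rw [Set.mem_preimage, Set.mem_compl_iff, Set.mem_ofPred_eq, Set.mem_ofPred_eq,
      ← PadicInt.toZMod_eq_iff, map_natCast, ZMod.natCast_zmod_val]
  rw [e]
  exact measurableSet_isUnit.compl.preimage (measurable_id.sub_const _)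

section Random

variable {Ω : Type*} [MeasurableSpace Ω] {P : Measure Ω} {n : ℕ} {ξ : Fin n → Ω → ℤ_[p]}

lemma measurable_eval_monicPoly (hm : ∀ i, Measurable (ξ i)) (x : ℤ_[p]) :
    Measurable fun ω => (monicPoly fun i => ξ i ω).eval x := by
  simp only [eval_monicPoly]
  fun_prop

lemma measurable_eval_derivative_monicPoly (hm : ∀ i, Measurable (ξ i)) (x : ℤ_[p]) :
    Measurable fun ω => (derivative (monicPoly fun i => ξ i ω)).eval x := by
  simp only [eval_derivative_monicPoly]
  fun_prop

variable {μ : Measure ℤ_[p]} [IsProbabilityMeasure μ]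

/-- The mean of a nontrivial character at `(f(x), f'(x))` factors over the coefficients, and at
least every second factor is bounded away from `1`. -/
lemma norm_integral_pair_char_le (hm : ∀ i, Measurable (ξ i)) (hi : iIndepFun ξ P)
    (hl : ∀ i, P.map (ξ i) = μ) {γ : ℝ} {k : ℕ} (hγ : ∀ (η : AddChar ℤ_[p] ℂ),
      (∀ z, η ((p : ℤ_[p]) ^ k * z) = 1) → (∃ z, η z ≠ 1) →
        ‖∫ z, η z ∂μ‖ ≤ Real.exp (-γ / (p : ℝ) ^ (2 * k)))
    {χ : AddChar (ℤ_[p] × ℤ_[p]) ℂ}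
    (hχ : ∀ y z, χ ((p : ℤ_[p]) ^ k * y, (p : ℤ_[p]) ^ k * z) = 1) (hne : ∃ v, χ v ≠ 1)
    {x : ℤ_[p]} (hx : IsUnit x) :
    ‖∫ ω, χ ((monicPoly fun i => ξ i ω).eval x,
      (derivative (monicPoly fun i => ξ i ω)).eval x) ∂P‖ ≤
        Real.exp (-γ / (p : ℝ) ^ (2 * k)) ^ (n / 2) := by
  set η : ℕ → AddChar ℤ_[p] ℂ := fun i => lineChar χ (x ^ i, i * x ^ (i - 1)) with hηdef
  have hη : ∀ i z, η i ((p : ℤ_[p]) ^ k * z) = 1 := fun i z => by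
    rw [hηdef]; simp only [lineChar_apply]
    rw [mul_assoc, mul_assoc]
    exact hχ _ _
  have hcont := fun i => AddChar.continuous_of_trivial (hη i)
  have hnorm := fun i => AddChar.norm_eq_one_of_trivial (hη i)
  have hexpand : ∀ ω, χ ((monicPoly fun i => ξ i ω).eval x,
      (derivative (monicPoly fun i => ξ i ω)).eval x) = (∏ i : Fin n, η i (ξ i ω)) * η n 1 := by
    intro ω
    have e : ((monicPoly fun i => ξ i ω).eval x,
        (derivative (monicPoly fun i => ξ i ω)).eval x) =
        (∑ i : Fin n, (ξ i ω * x ^ (i : ℕ), ξ i ω * (((i : ℕ) : ℤ_[p]) * x ^ ((i : ℕ) - 1))))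
          + (1 * x ^ n, 1 * ((n : ℤ_[p]) * x ^ (n - 1))) := by
      rw [eval_monicPoly, eval_derivative_monicPoly, one_mul, one_mul]
      ext <;> simp [Prod.fst_sum, Prod.snd_sum]
    rw [e, AddChar.map_add_eq_mul, AddChar.map_sum_eq_prod]
    rfl
  simp_rw [hexpand]
  rw [integral_mul_const, norm_mul, hnorm, mul_one]
  have hind : iIndepFun (fun (i : Fin n) ω => η i (ξ i ω)) P :=
    hi.comp (fun i : Fin n => ⇑(η i)) fun i => (hcont i).measurable
  rw [hind.integral_fun_prod_eq_prod_integral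
    (fun i => ((hcont i).measurable.comp (hm i)).aestronglyMeasurable), norm_prod]
  have heq : ∀ i : Fin n, ‖∫ ω, η i (ξ i ω) ∂P‖ = ‖∫ z, η i z ∂μ‖ := fun i => by
    rw [← hl i, integral_map (hm i).aemeasurable
      (hcont i).measurable.aestronglyMeasurable]
  simp_rw [heq]
  rw [Fin.prod_univ_eq_prod_range (fun i => ‖∫ z, η i z ∂μ‖) n]
  refine prod_range_le_pow_half (Real.exp_pos _).le (fun _ => norm_nonneg _) (fun i => ?_)
    (fun i => ?_) n
  · refine (norm_integral_le_integral_norm _).trans ?_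
    simp [hnorm]
  · exact (lineChar_ne_one_or hne hx i).imp (hγ _ (hη i)) (hγ _ (hη (i + 1)))

variable [IsProbabilityMeasure P]

/-- Joint equidistribution of `(f(x), f'(x))` at a unit `x`: in the Fourier expansion of the
indicator of the event, the trivial character gives the main term, and the error term bounds every
other one. -/
lemma abs_prob_pow_dvd_sub_le (hm : ∀ i, Measurable (ξ i)) (hi : iIndepFun ξ P)
    (hl : ∀ i, P.map (ξ i) = μ) {γ : ℝ} {k : ℕ} (hγ : ∀ (η : AddChar ℤ_[p] ℂ),
      (∀ z, η ((p : ℤ_[p]) ^ k * z) = 1) → (∃ z, η z ≠ 1) →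
        ‖∫ z, η z ∂μ‖ ≤ Real.exp (-γ / (p : ℝ) ^ (2 * k)))
    {x : ℤ_[p]} (hx : IsUnit x) {a b : ℕ} (ha : a ≤ k) (hb : b ≤ k) :
    |P.real {ω | (p : ℤ_[p]) ^ a ∣ (monicPoly fun i => ξ i ω).eval x ∧
        (p : ℤ_[p]) ^ b ∣ (derivative (monicPoly fun i => ξ i ω)).eval x} -
      ((p : ℝ) ^ (a + b))⁻¹| ≤ Real.exp (-γ / (p : ℝ) ^ (2 * k)) ^ (n / 2) := by
  set F : Ω → ℤ_[p] × ℤ_[p] := fun ω => ((monicPoly fun i => ξ i ω).eval x,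
    (derivative (monicPoly fun i => ξ i ω)).eval x) with hF
  set δ := Real.exp (-γ / (p : ℝ) ^ (2 * k)) ^ (n / 2) with hδ
  set V := {v : ℤ_[p] × ℤ_[p] | (p : ℤ_[p]) ^ a ∣ v.1 ∧ (p : ℤ_[p]) ^ b ∣ v.2} with hV
  have hp0 : (p : ℝ) ≠ 0 := by exact_mod_cast (Fact.out : p.Prime).ne_zero
  have hpos : (0 : ℝ) < (p : ℝ) ^ (a + b) := by
    have := (Fact.out : p.Prime).pos
    positivity
  have hFm : Measurable F :=
    (measurable_eval_monicPoly hm x).prodMk (measurable_eval_derivative_monicPoly hm x)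
  have hVm : MeasurableSet V :=
    ((measurableSet_pow_dvd a).preimage measurable_fst).inter
      ((measurableSet_pow_dvd b).preimage measurable_snd)
  have hchar : ∀ u w, Measurable (pairChar (p := p) a b u w) := by
    intro u w
    have h1 : Measurable fun y : ℤ_[p] => pairChar a b u w (y, 0) := by
      have : ∀ y, pairChar a b u w (y, 0) = lineChar (pairChar a b u w) (1, 0) y := fun y => by
        rw [lineChar_apply, mul_one, mul_zero]
      simp_rw [this]
      refine (AddChar.continuous_of_trivial (k := k) fun z => ?_).measurable
      rw [lineChar_apply, mul_assoc, mul_assoc]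
      exact pairChar_pow_mul ha hb _ _ _ _
    have h2 : Measurable fun y : ℤ_[p] => pairChar a b u w (0, y) := by
      have : ∀ y, pairChar a b u w (0, y) = lineChar (pairChar a b u w) (0, 1) y := fun y => by
        rw [lineChar_apply, mul_one, mul_zero]
      simp_rw [this]
      refine (AddChar.continuous_of_trivial (k := k) fun z => ?_).measurable
      rw [lineChar_apply, mul_assoc, mul_assoc]
      exact pairChar_pow_mul ha hb _ _ _ _
    have h3 : (pairChar (p := p) a b u w : ℤ_[p] × ℤ_[p] → ℂ) =
        fun v => pairChar a b u w (v.1, 0) * pairChar a b u w (0, v.2) := by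
      ext v
      rw [← AddChar.map_add_eq_mul]
      simp
    rw [h3]
    exact (h1.comp measurable_fst).mul (h2.comp measurable_snd)
  have hnorm : ∀ u w v, ‖pairChar (p := p) a b u w v‖ = 1 := fun u w v => by
    rw [show v = (v.1, v.2) from rfl, pairChar_apply]
    simp
  have hint : ∀ u w, Integrable (fun ω => pairChar a b u w (F ω)) P := fun u w =>
    Integrable.of_bound ((hchar u w).comp hFm).aestronglyMeasurable 1
      (ae_of_all _ fun _ => (hnorm _ _ _).le)
  have hmain : ((P.real (F ⁻¹' V) * (p : ℝ) ^ (a + b) : ℝ) : ℂ) =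
      ∑ uw : ZMod (p ^ a) × ZMod (p ^ b), ∫ ω, pairChar a b uw.1 uw.2 (F ω) ∂P := by
    rw [← integral_finsetSum _ fun uw _ => hint uw.1 uw.2]
    simp_rw [Fintype.sum_prod_type, hF, sum_pairChar]
    change _ = ∫ ω, (F ⁻¹' V).indicator (fun _ => (p : ℂ) ^ (a + b)) ω ∂P
    rw [integral_indicator_const _ (hFm hVm), Complex.real_smul]
    push_cast
    rfl
  have hzero : ∫ ω, pairChar a b (0 : ZMod (p ^ a)) (0 : ZMod (p ^ b)) (F ω) ∂P = 1 := by
    have : ∀ ω, pairChar a b (0 : ZMod (p ^ a)) (0 : ZMod (p ^ b)) (F ω) = 1 := fun ω => by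
      rw [hF, pairChar_apply]; simp
    simp_rw [this]
    simp
  have hnz : ∀ uw ∈ (Finset.univ : Finset (ZMod (p ^ a) × ZMod (p ^ b))).erase 0,
      ‖∫ ω, pairChar a b uw.1 uw.2 (F ω) ∂P‖ ≤ δ := by
    intro uw huw
    refine norm_integral_pair_char_le hm hi hl hγ (pairChar_pow_mul ha hb _ _) ?_ hx
    by_contra! hall
    obtain ⟨h1, h2⟩ := eq_zero_of_pairChar_eq_one fun y z => hall (y, z)
    exact (Finset.mem_erase.1 huw).1 (Prod.ext h1 h2)
  have hle : ‖((P.real (F ⁻¹' V) * (p : ℝ) ^ (a + b) - 1 : ℝ) : ℂ)‖ ≤ (p : ℝ) ^ (a + b) * δ := by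
    rw [Complex.ofReal_sub, hmain, ← Finset.add_sum_erase _ _ (Finset.mem_univ 0)]
    simp only [Prod.fst_zero, Prod.snd_zero]
    rw [hzero, Complex.ofReal_one, add_sub_cancel_left]
    refine (norm_sum_le_of_le _ hnz).trans ?_
    rw [Finset.sum_const, nsmul_eq_mul]
    refine mul_le_mul_of_nonneg_right ?_ (pow_nonneg (Real.exp_pos _).le _)
    have hc : ((Finset.univ : Finset (ZMod (p ^ a) × ZMod (p ^ b))).erase 0).card ≤
        p ^ (a + b) := by
      refine (Finset.card_erase_le).trans (le_of_eq ?_)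
      rw [Finset.card_univ, Fintype.card_prod, ZMod.card, ZMod.card, pow_add]
    exact_mod_cast hc
  rw [Complex.norm_real, Real.norm_eq_abs] at hle
  have e : P.real (F ⁻¹' V) - ((p : ℝ) ^ (a + b))⁻¹ =
      ((p : ℝ) ^ (a + b))⁻¹ * (P.real (F ⁻¹' V) * (p : ℝ) ^ (a + b) - 1) := by
    field_simp
  change |P.real (F ⁻¹' V) - ((p : ℝ) ^ (a + b))⁻¹| ≤ δ
  rw [e, abs_mul, abs_of_pos (inv_pos.2 hpos), inv_mul_le_iff₀ hpos]
  exact hle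

/-- If `f mod p` is divisible by `(X - r) ^ d`, then its coefficients of index at least `d`
determine the others, so each of these `d` coefficients is forced into one residue class. -/
lemma prob_pow_dvd_map_le (hm : ∀ i, Measurable (ξ i)) (hi : iIndepFun ξ P)
    (hl : ∀ i, P.map (ξ i) = μ) {α : ℝ} (hα : ∀ c : ZMod p, μ.real {x | PadicInt.toZMod x = c} ≤ α)
    (r : ZMod p) (d : ℕ) :
    P.real {ω | (X - C r) ^ d ∣ (monicPoly fun i => ξ i ω).map PadicInt.toZMod} ≤ α ^ d := by
  classical
  have hα0 : 0 ≤ α := measureReal_nonneg.trans (hα 0)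
  have hmon : ((X - C r) ^ d).Monic := (monic_X_sub_C r).pow d
  have hdeg : ((X - C r) ^ d).natDegree = d := by
    rw [(monic_X_sub_C r).natDegree_pow, natDegree_X_sub_C, mul_one]
  rcases lt_or_ge n d with hnd | hdn
  · have : {ω | (X - C r) ^ d ∣ (monicPoly fun i => ξ i ω).map PadicInt.toZMod} = ∅ := by
      refine Set.eq_empty_of_forall_notMem fun ω hω => ?_
      rw [Set.mem_ofPred_eq, map_monicPoly] at hω
      have := natDegree_le_of_dvd hω (monic_monicPoly _).ne_zero
      rw [hdeg, natDegree_monicPoly] at this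
      omega
    rw [this, measureReal_empty]
    positivity
  set w : ZMod p → ℝ := fun c => μ.real {x | PadicInt.toZMod x = c} with hw
  have hclass := measurableSet_toZMod_eq (p := p)
  have hw1 : ∑ c, w c = 1 := by
    rw [hw, ← measureReal_biUnion_finset]
    · have : (⋃ b ∈ (Finset.univ : Finset (ZMod p)), {x : ℤ_[p] | PadicInt.toZMod x = b}) =
          Set.univ := by ext; simp
      rw [this, probReal_univ]
    · intro a _ b _ hab
      rw [Function.onFun, Set.disjoint_left]
      rintro x h1 h2
      exact hab (h1.symm.trans h2)
    · exact fun c _ => hclass c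
  have hprob : ∀ v : Fin n → ZMod p,
      P.real {ω | ∀ i, PadicInt.toZMod (ξ i ω) = v i} = ∏ i, w (v i) := by
    intro v
    have h1 := hi.measure_inter_preimage_eq_mul Finset.univ
      (sets := fun i => {x : ℤ_[p] | PadicInt.toZMod x = v i}) fun i _ => hclass _
    have h2 : {ω | ∀ i, PadicInt.toZMod (ξ i ω) = v i} =
        ⋂ i ∈ (Finset.univ : Finset (Fin n)), ξ i ⁻¹' {x : ℤ_[p] | PadicInt.toZMod x = v i} := by
      ext; simp
    rw [h2, measureReal_def, h1, ENNReal.toReal_prod]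
    refine Finset.prod_congr rfl fun i _ => ?_
    rw [← Measure.map_apply (hm i) (hclass _), hl i]
    rfl
  set S : Finset (Fin n → ZMod p) := Finset.univ.filter fun v => (X - C r) ^ d ∣ monicPoly v
  have hS : {ω | (X - C r) ^ d ∣ (monicPoly fun i => ξ i ω).map PadicInt.toZMod} ⊆
      ⋃ v ∈ S, {ω | ∀ i, PadicInt.toZMod (ξ i ω) = v i} := by
    intro ω hω
    rw [Set.mem_ofPred_eq, map_monicPoly] at hω
    simp only [Set.mem_iUnion]
    exact ⟨fun i => PadicInt.toZMod (ξ i ω), Finset.mem_filter.2 ⟨Finset.mem_univ _, hω⟩,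
      fun i => rfl⟩
  -- `ρ` keeps the coefficients of index at least `d`; two members of `S` that agree there differ by
  -- a polynomial of degree less than `d` divisible by `(X - r) ^ d`
  set ρ : (Fin n → ZMod p) → ({i : Fin n // ¬ (i : ℕ) < d} → ZMod p) := fun v i => v i
  have hinj : Set.InjOn ρ S := by
    intro v hv v' hv' hvv
    have h1 := (Finset.mem_filter.1 hv).2
    have h2 := (Finset.mem_filter.1 hv').2
    have h3 := dvd_sub h1 h2
    have h4 : monicPoly v - monicPoly v' = 0 := by
      apply eq_zero_of_dvd_of_degree_lt h3
      rw [degree_eq_natDegree hmon.ne_zero, hdeg, degree_lt_iff_coeff_zero]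
      intro m hm
      rw [coeff_sub, sub_eq_zero]
      rcases lt_trichotomy m n with hmn | rfl | hmn
      · have := congrFun hvv ⟨⟨m, hmn⟩, not_lt.2 hm⟩
        rw [coeff_monicPoly v ⟨m, hmn⟩, coeff_monicPoly v' ⟨m, hmn⟩]
        exact this
      · have e1 := (monic_monicPoly v).coeff_natDegree
        have e2 := (monic_monicPoly v').coeff_natDegree
        rw [natDegree_monicPoly] at e1 e2
        rw [e1, e2]
      · rw [coeff_eq_zero_of_natDegree_lt, coeff_eq_zero_of_natDegree_lt] <;>
          rwa [natDegree_monicPoly]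
    ext i
    rw [← coeff_monicPoly v, ← coeff_monicPoly v', sub_eq_zero.1 h4]
  have hw0 : ∀ c, 0 ≤ w c := fun c => measureReal_nonneg
  have hcard : Fintype.card {i : Fin n // (i : ℕ) < d} = d := by
    rw [Fintype.card_subtype, Fin.card_filter_val_lt, min_eq_right hdn]
  calc P.real {ω | (X - C r) ^ d ∣ (monicPoly fun i => ξ i ω).map PadicInt.toZMod}
      ≤ P.real (⋃ v ∈ S, {ω | ∀ i, PadicInt.toZMod (ξ i ω) = v i}) :=
        measureReal_mono hS (measure_ne_top _ _)
    _ ≤ ∑ v ∈ S, P.real {ω | ∀ i, PadicInt.toZMod (ξ i ω) = v i} :=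
        measureReal_biUnion_finset_le _ _
    _ = ∑ v ∈ S, (∏ i : {i : Fin n // (i : ℕ) < d}, w (v i)) *
          ∏ i : {i : Fin n // ¬ (i : ℕ) < d}, w (ρ v i) := by
        refine Finset.sum_congr rfl fun v _ => ?_
        rw [hprob, Fintype.prod_subtype_mul_prod_subtype (fun i : Fin n => (i : ℕ) < d)
          (fun i => w (v i))]
    _ ≤ ∑ v ∈ S, α ^ d * ∏ i : {i : Fin n // ¬ (i : ℕ) < d}, w (ρ v i) := by
        refine Finset.sum_le_sum fun v _ => mul_le_mul_of_nonneg_right ?_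
          (Finset.prod_nonneg fun i _ => hw0 _)
        refine (Finset.prod_le_prod (fun i _ => hw0 _) fun i _ => hα _).trans (le_of_eq ?_)
        rw [Finset.prod_const, Finset.card_univ, hcard]
    _ = α ^ d * ∑ v ∈ S.image ρ, ∏ i : {i : Fin n // ¬ (i : ℕ) < d}, w (v i) := by
        rw [Finset.sum_image hinj, Finset.mul_sum]
    _ ≤ α ^ d * ∑ v : {i : Fin n // ¬ (i : ℕ) < d} → ZMod p, ∏ i, w (v i) := by
        refine mul_le_mul_of_nonneg_left (Finset.sum_le_univ_sum_of_nonneg fun v =>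
          Finset.prod_nonneg fun i _ => hw0 _) (pow_nonneg hα0 _)
    _ = α ^ d := by
        rw [← Fintype.piFinset_univ, ← Finset.prod_univ_sum]
        simp [hw1]

end Random

end

/-! ### Measurability of the number of roots -/

section

lemma exists_dist_ge_iff_injective {X : Type*} [MetricSpace X] {m : ℕ} (x : Fin m → X) :
    (∃ k : ℕ, ∀ i j, i ≠ j → 1 / ((k : ℝ) + 1) ≤ dist (x i) (x j)) ↔ Function.Injective x := by
  constructor
  · rintro ⟨k, hk⟩ i j hij
    by_contra hne
    have := hk i j hne
    rw [hij, dist_self] at this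
    exact absurd this (not_le.2 (by positivity))
  · intro hx
    have : ∀ᶠ k : ℕ in Filter.atTop, ∀ i j, i ≠ j → 1 / ((k : ℝ) + 1) ≤ dist (x i) (x j) := by
      simp only [Filter.eventually_all]
      intro i j hij
      exact (tendsto_one_div_add_atTop_nhds_zero_nat.eventually
        (gt_mem_nhds (dist_pos.2 (hx.ne hij)))).mono fun _ h => h.le
    exact this.exists

lemma Set.Finite.le_ncard_iff_exists_injective {X : Type*} {S : Set X} (hS : S.Finite) {m : ℕ} :
    m ≤ S.ncard ↔ ∃ x : Fin m → X, Function.Injective x ∧ ∀ i, x i ∈ S := by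
  constructor
  · intro h
    obtain ⟨T, hT, hc⟩ := Set.exists_subset_card_eq h
    have hfin : T.Finite := hS.subset hT
    obtain ⟨T', rfl⟩ := hfin.exists_finset_coe
    rw [Set.ncard_coe_finset] at hc
    subst hc
    exact ⟨fun i => T'.equivFin.symm i, Subtype.val_injective.comp T'.equivFin.symm.injective,
      fun i => hT (T'.equivFin.symm i).2⟩
  · rintro ⟨x, hx, hm⟩
    calc m = (Set.range x).ncard := by
          rw [← Set.image_univ, Set.ncard_image_of_injective _ hx, Set.ncard_univ]; simp
      _ ≤ S.ncard := Set.ncard_le_ncard (by rintro _ ⟨i, rfl⟩; exact hm i) hS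

variable {p : ℕ} [Fact p.Prime]

lemma continuous_eval_monicPoly {n : ℕ} :
    Continuous fun z : ℤ_[p] × (Fin n → ℤ_[p]) => (monicPoly z.2).eval z.1 := by
  simp only [eval_monicPoly]
  fun_prop

variable [MeasurableSpace ℤ_[p]] [BorelSpace ℤ_[p]]

/-- The number of roots in a closed set is a measurable function of the coefficients: having at
least `m` roots at pairwise distance at least `1 / (k + 1)` is a closed condition, because `ℤ_[p]`
is compact. -/
lemma measurable_ncard_roots {n : ℕ} {B : Set ℤ_[p]} (hB : IsClosed B) :
    Measurable fun c : Fin n → ℤ_[p] => {x : ℤ_[p] | (monicPoly c).eval x = 0 ∧ x ∈ B}.ncard := by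
  refine measurable_of_Ici fun m => ?_
  set A : ℕ → Set ((Fin m → ℤ_[p]) × (Fin n → ℤ_[p])) := fun k =>
    {z | (∀ i, (monicPoly z.2).eval (z.1 i) = 0 ∧ z.1 i ∈ B) ∧
      ∀ i j, i ≠ j → 1 / ((k : ℝ) + 1) ≤ dist (z.1 i) (z.1 j)} with hA
  have hclosed : ∀ k, IsClosed (A k) := by
    intro k
    simp only [hA, Set.ofPred_and, Set.ofPred_forall]
    refine IsClosed.inter (isClosed_iInter fun i => IsClosed.inter ?_ ?_)
      (isClosed_iInter fun i => isClosed_iInter fun j => isClosed_iInter fun _ => ?_)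
    · refine isClosed_eq ?_ continuous_const
      have h1 : Continuous fun z : (Fin m → ℤ_[p]) × (Fin n → ℤ_[p]) => (z.1 i, z.2) := by
        fun_prop
      exact continuous_eval_monicPoly.comp h1
    · exact hB.preimage ((continuous_apply i).comp continuous_fst)
    · exact isClosed_le continuous_const (by fun_prop)
  have heq : (fun c : Fin n → ℤ_[p] => {x : ℤ_[p] | (monicPoly c).eval x = 0 ∧ x ∈ B}.ncard) ⁻¹'
      Set.Ici m = ⋃ k, Prod.snd '' A k := by
    ext c
    have hfin : {x : ℤ_[p] | (monicPoly c).eval x = 0 ∧ x ∈ B}.Finite :=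
      (finite_setOf_eval_eq_zero (monic_monicPoly c).ne_zero).subset fun x hx => hx.1
    rw [Set.mem_preimage, Set.mem_Ici, hfin.le_ncard_iff_exists_injective]
    simp only [Set.mem_iUnion, Set.mem_image, Prod.exists, exists_eq_right,
      ← exists_dist_ge_iff_injective]
    constructor
    · rintro ⟨x, ⟨k, hk⟩, hx⟩
      exact ⟨k, x, hx, hk⟩
    · rintro ⟨k, x, hx, hk⟩
      exact ⟨x, ⟨k, hk⟩, hx⟩
  rw [heq]
  exact MeasurableSet.iUnion fun k =>
    (isClosedMap_snd_of_compactSpace _ (hclosed k)).measurableSet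

lemma integrable_ncard_roots {Ω : Type*} [MeasurableSpace Ω] {P : Measure Ω}
    [IsProbabilityMeasure P] {n : ℕ} {ξ : Fin n → Ω → ℤ_[p]} (hm : ∀ i, Measurable (ξ i))
    {B : Set ℤ_[p]} (hB : IsClosed B) :
    Integrable (fun ω => ({x : ℤ_[p] | (monicPoly fun i => ξ i ω).eval x = 0 ∧ x ∈ B}.ncard : ℝ))
      P := by
  refine Integrable.of_bound (C := n) ?_ (ae_of_all _ fun ω => ?_)
  · exact (measurable_from_top.comp ((measurable_ncard_roots hB).comp
      (measurable_pi_lambda _ hm)) : Measurable ((fun k : ℕ => (k : ℝ)) ∘ _)).aestronglyMeasurable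
  · rw [Real.norm_natCast, Nat.cast_le]
    exact (ncard_le_natDegree_of_eval_eq_zero (monic_monicPoly _).ne_zero fun x hx => hx.1).trans
      (natDegree_monicPoly _).le

end

/-! ### Expected number of unit roots -/

section

variable {p : ℕ} [Fact p.Prime]

/-- Representatives of the unit residue classes modulo `p ^ m`. -/
def unitReps (p m : ℕ) : Finset ℕ := (Finset.range (p ^ m)).filter fun a => ¬ p ∣ a

lemma card_unitReps (l : ℕ) : (unitReps p (l + 1)).card = (p - 1) * p ^ l := by
  have hp : p.Prime := Fact.out
  rw [mul_comm, ← Nat.totient_prime_pow_succ hp, Nat.totient, unitReps]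
  congr 1
  refine Finset.filter_congr fun a _ => ?_
  rw [Nat.coprime_pow_left_iff l.succ_pos, hp.coprime_iff_not_dvd]

lemma unitReps_isUnit {m a : ℕ} (ha : a ∈ unitReps p m) : IsUnit (a : ℤ_[p]) :=
  PadicInt.isUnit_natCast_iff.2 (Finset.mem_filter.1 ha).2

/-- The polynomials `f` with `p ^ i ∣ f(a)` and `p ^ j ∣ f'(a)`. -/
def evalDvd (p : ℕ) [Fact p.Prime] (i j a : ℕ) : Set ℤ_[p][X] :=
  {f | (p : ℤ_[p]) ^ i ∣ f.eval (a : ℤ_[p]) ∧ (p : ℤ_[p]) ^ j ∣ (derivative f).eval (a : ℤ_[p])}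

/-- The number of unit roots of `f` at which `f'` has valuation less than `s`, written through
congruence conditions on `f` and `f'` at finitely many points. -/
noncomputable def simpleCount (s : ℕ) (f : ℤ_[p][X]) : ℝ :=
  ∑ l ∈ Finset.range s, ∑ a ∈ unitReps p (l + 1),
    ((evalDvd p (2 * l + 1) l a).indicator 1 f - (evalDvd p (2 * l + 1) (l + 1) a).indicator 1 f)

/-- The inner sum of `simpleCount` counts the unit roots at which `f'` has valuation exactly `l`. -/
lemma ncard_valuation_eq_sum (f : ℤ_[p][X]) (l : ℕ) :
    ({x : ℤ_[p] | (f.eval x = 0 ∧ IsUnit x) ∧ (p : ℤ_[p]) ^ l ∣ (derivative f).eval x ∧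
        ¬ (p : ℤ_[p]) ^ (l + 1) ∣ (derivative f).eval x}.ncard : ℝ) =
      ∑ a ∈ unitReps p (l + 1), ((evalDvd p (2 * l + 1) l a).indicator 1 f -
        (evalDvd p (2 * l + 1) (l + 1) a).indicator 1 f) := by
  classical
  have e : {a : ℕ | (a < p ^ (l + 1) ∧ ¬ p ∣ a) ∧ (p : ℤ_[p]) ^ (2 * l + 1) ∣ f.eval (a : ℤ_[p]) ∧
        (p : ℤ_[p]) ^ l ∣ (derivative f).eval (a : ℤ_[p]) ∧
        ¬ (p : ℤ_[p]) ^ (l + 1) ∣ (derivative f).eval (a : ℤ_[p])} =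
      ((unitReps p (l + 1)).filter fun a : ℕ => (p : ℤ_[p]) ^ (2 * l + 1) ∣ f.eval (a : ℤ_[p]) ∧
        (p : ℤ_[p]) ^ l ∣ (derivative f).eval (a : ℤ_[p]) ∧
        ¬ (p : ℤ_[p]) ^ (l + 1) ∣ (derivative f).eval (a : ℤ_[p]) : Finset ℕ) := by
    ext a
    simp [unitReps]
  rw [ncard_unitRoots_valuation_eq, e, Set.ncard_coe_finset, Finset.card_filter]
  push_cast
  refine Finset.sum_congr rfl fun a _ => ?_
  have hmono : (p : ℤ_[p]) ^ (l + 1) ∣ (derivative f).eval (a : ℤ_[p]) →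
      (p : ℤ_[p]) ^ l ∣ (derivative f).eval (a : ℤ_[p]) := (pow_dvd_pow _ l.le_succ).trans
  simp only [Set.indicator_apply, evalDvd, Set.mem_ofPred_eq, Pi.one_apply]
  by_cases h0 : (p : ℤ_[p]) ^ (2 * l + 1) ∣ f.eval (a : ℤ_[p]) <;>
    by_cases h1 : (p : ℤ_[p]) ^ (l + 1) ∣ (derivative f).eval (a : ℤ_[p]) <;>
    by_cases h2 : (p : ℤ_[p]) ^ l ∣ (derivative f).eval (a : ℤ_[p]) <;> simp_all

/-- The unit roots split according to whether the valuation of the derivative is less than `s`. -/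
lemma ncard_unitRoots_eq (f : ℤ_[p][X]) (hf : f ≠ 0) (s : ℕ) :
    ({x : ℤ_[p] | f.eval x = 0 ∧ IsUnit x}.ncard : ℝ) = simpleCount s f +
      {x : ℤ_[p] | (f.eval x = 0 ∧ IsUnit x) ∧ (p : ℤ_[p]) ^ s ∣ (derivative f).eval x}.ncard := by
  have hfin := finite_setOf_eval_eq_zero hf
  induction s with
  | zero => simp [simpleCount]
  | succ s ih =>
    rw [ih, simpleCount, simpleCount, Finset.sum_range_succ, add_assoc, ← ncard_valuation_eq_sum,
      ← Nat.cast_add, ← Set.ncard_union_eq ?_ (hfin.subset fun x hx => hx.1.1)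
        (hfin.subset fun x hx => hx.1.1)]
    · congr 3
      ext x
      have hmono : (p : ℤ_[p]) ^ (s + 1) ∣ (derivative f).eval x →
        (p : ℤ_[p]) ^ s ∣ (derivative f).eval x := (pow_dvd_pow _ s.le_succ).trans
      simp only [Set.mem_union, Set.mem_ofPred_eq]
      tauto
    · rw [Set.disjoint_left]
      rintro x ⟨_, _, h⟩ ⟨_, h'⟩
      exact h h'

/-- Unit roots with a highly divisible derivative exist only if a rare congruence holds at some
representative, and they are few unless `f mod p` has a root of high multiplicity. -/
lemma ncard_degenerate_le {f : ℤ_[p][X]} (hf : f ≠ 0) (s d : ℕ) :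
    ({x : ℤ_[p] | (f.eval x = 0 ∧ IsUnit x) ∧
        (p : ℤ_[p]) ^ s ∣ (derivative f).eval x}.ncard : ℝ) ≤
      (p * d) * ∑ a ∈ unitReps p (s + 1), (evalDvd p (2 * s + 1) s a).indicator 1 f +
        f.natDegree * ∑ r : ZMod p,
          {g : ℤ_[p][X] | (X - C r) ^ d ∣ g.map PadicInt.toZMod}.indicator 1 f := by
  classical
  set W := {x : ℤ_[p] | (f.eval x = 0 ∧ IsUnit x) ∧
    (p : ℤ_[p]) ^ s ∣ (derivative f).eval x} with hW
  have hnn : ∀ (S : Set ℤ_[p][X]), 0 ≤ S.indicator (1 : ℤ_[p][X] → ℝ) f := fun S =>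
    Set.indicator_nonneg (fun _ _ => zero_le_one) _
  have hnn1 : 0 ≤ ∑ a ∈ unitReps p (s + 1),
      (evalDvd p (2 * s + 1) s a).indicator (1 : ℤ_[p][X] → ℝ) f :=
    Finset.sum_nonneg fun _ _ => hnn _
  have hnn2 : 0 ≤ ∑ r : ZMod p, {g : ℤ_[p][X] | (X - C r) ^ d ∣ g.map PadicInt.toZMod}.indicator
      (1 : ℤ_[p][X] → ℝ) f := Finset.sum_nonneg fun _ _ => hnn _
  rcases lt_or_ge (p * d) W.ncard with h | h
  · obtain ⟨r, hr⟩ := exists_pow_dvd_map_of_lt_ncard hf (B := W) (fun x hx => hx.1.1) h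
    have h1 : (1 : ℝ) ≤ ∑ r : ZMod p, {g : ℤ_[p][X] |
        (X - C r) ^ d ∣ g.map PadicInt.toZMod}.indicator 1 f := by
      refine le_trans (le_of_eq ?_)
        (Finset.single_le_sum (fun _ _ => hnn _) (Finset.mem_univ r))
      rw [Set.indicator_of_mem (by exact hr)]; rfl
    have h2 : (W.ncard : ℝ) ≤ f.natDegree := by
      exact_mod_cast ncard_le_natDegree_of_eval_eq_zero hf (B := W) fun x hx => hx.1.1
    calc (W.ncard : ℝ) ≤ 0 + f.natDegree * 1 := by linarith
      _ ≤ _ := by gcongr; positivity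
  · rcases W.eq_empty_or_nonempty with h0 | ⟨x, ⟨hx, hu⟩, hs⟩
    · rw [h0, Set.ncard_empty]
      push_cast
      positivity
    · obtain ⟨a, ⟨ha, hpa⟩, h1, h2⟩ := exists_natCast_of_degenerate_root hx hu hs
      have hmem : a ∈ unitReps p (s + 1) := Finset.mem_filter.2 ⟨Finset.mem_range.2 ha, hpa⟩
      have h3 : (1 : ℝ) ≤ ∑ a ∈ unitReps p (s + 1),
          (evalDvd p (2 * s + 1) s a).indicator 1 f := by
        refine le_trans (le_of_eq ?_) (Finset.single_le_sum (fun _ _ => hnn _) hmem)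
        rw [Set.indicator_of_mem (by exact ⟨h1, h2⟩)]; rfl
      have h4 : (W.ncard : ℝ) ≤ p * d := by exact_mod_cast h
      calc (W.ncard : ℝ) ≤ (p * d) * 1 + 0 := by linarith
        _ ≤ _ := by gcongr; positivity

lemma isClosed_isUnit : IsClosed {x : ℤ_[p] | IsUnit x} := by
  simp only [PadicInt.isUnit_iff]
  exact isClosed_eq continuous_norm continuous_const

lemma isClosed_not_isUnit : IsClosed {x : ℤ_[p] | ¬ IsUnit x} := by
  simp only [PadicInt.isUnit_iff_not_dvd, not_not]
  have : {x : ℤ_[p] | (p : ℤ_[p]) ∣ x} = {x | ‖x‖ ≤ (p : ℝ) ^ (-((1 : ℕ) : ℤ))} := by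
    ext x
    rw [Set.mem_ofPred_eq, Set.mem_ofPred_eq, ← PadicInt.pow_dvd_iff_norm_le, pow_one]
  rw [this]
  exact isClosed_le continuous_norm continuous_const

variable [MeasurableSpace ℤ_[p]] [BorelSpace ℤ_[p]]

section Random

variable {Ω : Type*} [MeasurableSpace Ω] {P : Measure Ω} {n : ℕ} {ξ : Fin n → Ω → ℤ_[p]}

lemma measurableSet_evalDvd (hm : ∀ i, Measurable (ξ i)) (i j a : ℕ) :
    MeasurableSet {ω | (monicPoly fun i => ξ i ω) ∈ evalDvd p i j a} :=
  ((measurableSet_pow_dvd i).preimage (measurable_eval_monicPoly hm _)).inter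
    ((measurableSet_pow_dvd j).preimage (measurable_eval_derivative_monicPoly hm _))

lemma integral_indicator_evalDvd (hm : ∀ i, Measurable (ξ i)) (i j a : ℕ) :
    ∫ ω, (evalDvd p i j a).indicator (1 : ℤ_[p][X] → ℝ) (monicPoly fun i => ξ i ω) ∂P =
      P.real {ω | (monicPoly fun i => ξ i ω) ∈ evalDvd p i j a} :=
  integral_indicator_one (measurableSet_evalDvd hm i j a)

variable [IsProbabilityMeasure P]

lemma integrable_indicator_evalDvd (hm : ∀ i, Measurable (ξ i)) (i j a : ℕ) :
    Integrable (fun ω => (evalDvd p i j a).indicator (1 : ℤ_[p][X] → ℝ)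
      (monicPoly fun i => ξ i ω)) P :=
  (integrable_const (1 : ℝ)).indicator (measurableSet_evalDvd hm i j a)

lemma integrable_indicator_evalDvd_sub (hm : ∀ i, Measurable (ξ i)) (l a : ℕ) :
    Integrable (fun ω => (evalDvd p (2 * l + 1) l a).indicator (1 : ℤ_[p][X] → ℝ)
        (monicPoly fun i => ξ i ω) -
      (evalDvd p (2 * l + 1) (l + 1) a).indicator 1 (monicPoly fun i => ξ i ω)) P :=
  (integrable_indicator_evalDvd hm _ _ _).sub (integrable_indicator_evalDvd hm _ _ _)

lemma integrable_simpleCount (hm : ∀ i, Measurable (ξ i)) (s : ℕ) :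
    Integrable (fun ω => simpleCount s (monicPoly fun i => ξ i ω)) P := by
  unfold simpleCount
  exact integrable_finsetSum _ fun l _ => integrable_finsetSum _ fun a _ =>
    integrable_indicator_evalDvd_sub hm l a

/-- The expected number of unit roots with derivative of valuation less than `s`, given the
equidistribution of `(f(a), f'(a))` up to an error `δ`. -/
lemma abs_integral_simpleCount_sub_le (hm : ∀ i, Measurable (ξ i)) {s : ℕ} {δ : ℝ}
    (hδ : ∀ x : ℤ_[p], IsUnit x → ∀ i j : ℕ, i ≤ 2 * s + 1 → j ≤ 2 * s + 1 →
      |P.real {ω | (p : ℤ_[p]) ^ i ∣ (monicPoly fun i => ξ i ω).eval x ∧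
        (p : ℤ_[p]) ^ j ∣ (derivative (monicPoly fun i => ξ i ω)).eval x} -
      ((p : ℝ) ^ (i + j))⁻¹| ≤ δ) :
    |∫ ω, simpleCount s (monicPoly fun i => ξ i ω) ∂P -
      ∑ l ∈ Finset.range s, ((p : ℝ) - 1) * p ^ l * (((p : ℝ) ^ (2 * l + 1 + l))⁻¹ -
        ((p : ℝ) ^ (2 * l + 1 + (l + 1)))⁻¹)| ≤ 2 * p ^ s * δ := by
  have hp1 : (1 : ℕ) ≤ p := (Fact.out : p.Prime).one_lt.le
  have hδ0 : 0 ≤ δ := (abs_nonneg _).trans (hδ 1 isUnit_one 0 0 (by omega) (by omega))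
  have hcard : ∀ l, ((unitReps p (l + 1)).card : ℝ) = ((p : ℝ) - 1) * p ^ l := fun l => by
    rw [card_unitReps]; push_cast [Nat.cast_sub hp1]; ring
  unfold simpleCount
  rw [integral_finsetSum _ fun l _ => integrable_finsetSum _ fun a _ =>
    integrable_indicator_evalDvd_sub hm l a,
    ← Finset.sum_sub_distrib]
  have hterm : ∀ l ∈ Finset.range s, |(∫ ω, ∑ a ∈ unitReps p (l + 1),
      ((evalDvd p (2 * l + 1) l a).indicator (1 : ℤ_[p][X] → ℝ) (monicPoly fun i => ξ i ω) -
        (evalDvd p (2 * l + 1) (l + 1) a).indicator 1 (monicPoly fun i => ξ i ω)) ∂P) -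
      ((p : ℝ) - 1) * p ^ l * (((p : ℝ) ^ (2 * l + 1 + l))⁻¹ -
        ((p : ℝ) ^ (2 * l + 1 + (l + 1)))⁻¹)| ≤ ((p : ℝ) - 1) * p ^ l * (2 * δ) := by
    intro l hl
    have hls := Finset.mem_range.1 hl
    rw [integral_finsetSum _ fun a _ =>
      integrable_indicator_evalDvd_sub hm l a,
      ← hcard, ← nsmul_eq_mul, ← Finset.sum_const, ← Finset.sum_sub_distrib, ← nsmul_eq_mul,
      ← Finset.sum_const]
    refine (Finset.abs_sum_le_sum_abs _ _).trans (Finset.sum_le_sum fun a ha => ?_)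
    rw [integral_sub (integrable_indicator_evalDvd hm _ _ _)
      (integrable_indicator_evalDvd hm _ _ _), integral_indicator_evalDvd hm,
      integral_indicator_evalDvd hm]
    have h1 := hδ a (unitReps_isUnit ha) (2 * l + 1) l (by omega) (by omega)
    have h2 := hδ a (unitReps_isUnit ha) (2 * l + 1) (l + 1) (by omega) (by omega)
    rw [sub_sub_sub_comm, two_mul δ]
    exact (abs_sub _ _).trans (add_le_add h1 h2)
  refine (Finset.abs_sum_le_sum_abs _ _).trans ((Finset.sum_le_sum hterm).trans ?_)
  rw [← Finset.sum_mul, ← Finset.mul_sum, mul_comm ((p : ℝ) - 1), geom_sum_mul]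
  have : ((p : ℝ) ^ s - 1) * (2 * δ) ≤ p ^ s * (2 * δ) := by gcongr; linarith
  linarith

/-- The expected number of unit roots at which `p ^ s ∣ f'`, where `β` bounds the probability of a
root of multiplicity `d` modulo `p`. -/
lemma integral_degenerate_le (hm : ∀ i, Measurable (ξ i)) {s d : ℕ} {δ β : ℝ}
    (hδ : ∀ x : ℤ_[p], IsUnit x → ∀ i j : ℕ, i ≤ 2 * s + 1 → j ≤ 2 * s + 1 →
      |P.real {ω | (p : ℤ_[p]) ^ i ∣ (monicPoly fun i => ξ i ω).eval x ∧
        (p : ℤ_[p]) ^ j ∣ (derivative (monicPoly fun i => ξ i ω)).eval x} -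
      ((p : ℝ) ^ (i + j))⁻¹| ≤ δ)
    (hβ : ∀ r : ZMod p,
      P.real {ω | (X - C r) ^ d ∣ (monicPoly fun i => ξ i ω).map PadicInt.toZMod} ≤ β) :
    ∫ ω, ({x : ℤ_[p] | ((monicPoly fun i => ξ i ω).eval x = 0 ∧ IsUnit x) ∧
        (p : ℤ_[p]) ^ s ∣ (derivative (monicPoly fun i => ξ i ω)).eval x}.ncard : ℝ) ∂P ≤
      p * d * (p ^ (s + 1) * (((p : ℝ) ^ (2 * s + 1 + s))⁻¹ + δ)) + n * (p * β) := by
  have hδ0 : 0 ≤ δ := (abs_nonneg _).trans (hδ 1 isUnit_one 0 0 (by omega) (by omega))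
  have hp0 : 0 < p := (Fact.out : p.Prime).pos
  -- measurable hulls spare a proof that divisibility modulo `p` is a measurable event
  set D : ZMod p → Set Ω := fun r => toMeasurable P
    {ω | (X - C r) ^ d ∣ (monicPoly fun i => ξ i ω).map PadicInt.toZMod} with hD
  have hDm : ∀ r, MeasurableSet (D r) := fun r => measurableSet_toMeasurable _ _
  have hDi : ∀ r, Integrable ((D r).indicator (1 : Ω → ℝ)) P := fun r =>
    (integrable_const (1 : ℝ)).indicator (hDm r)
  have hI : Integrable (fun ω => (p * d : ℝ) * ∑ a ∈ unitReps p (s + 1),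
      (evalDvd p (2 * s + 1) s a).indicator (1 : ℤ_[p][X] → ℝ) (monicPoly fun i => ξ i ω)) P :=
    (integrable_finsetSum _ fun a _ => integrable_indicator_evalDvd hm _ _ _).const_mul _
  have hJ : Integrable (fun ω => (n : ℝ) * ∑ r : ZMod p, (D r).indicator (1 : Ω → ℝ) ω) P :=
    (integrable_finsetSum _ fun r _ => hDi r).const_mul _
  calc _ ≤ ∫ ω, ((p * d : ℝ) * ∑ a ∈ unitReps p (s + 1),
        (evalDvd p (2 * s + 1) s a).indicator (1 : ℤ_[p][X] → ℝ) (monicPoly fun i => ξ i ω) +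
          n * ∑ r : ZMod p, (D r).indicator (1 : Ω → ℝ) ω) ∂P := by
        refine integral_mono_of_nonneg (ae_of_all _ fun ω => Nat.cast_nonneg _) (hI.add hJ)
          (ae_of_all _ fun ω => ?_)
        refine (ncard_degenerate_le (monic_monicPoly _).ne_zero s d).trans ?_
        rw [natDegree_monicPoly]
        refine add_le_add le_rfl (mul_le_mul_of_nonneg_left (Finset.sum_le_sum fun r _ => ?_)
          (Nat.cast_nonneg _))
        by_cases h : (X - C r) ^ d ∣ (monicPoly fun i => ξ i ω).map PadicInt.toZMod
        · rw [Set.indicator_of_mem (by exact h), Set.indicator_of_mem (subset_toMeasurable P _ h)]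
          rfl
        · rw [Set.indicator_of_notMem (by exact h)]
          exact Set.indicator_nonneg (fun _ _ => zero_le_one) _
    _ = (p * d : ℝ) * ∑ a ∈ unitReps p (s + 1),
          P.real {ω | (monicPoly fun i => ξ i ω) ∈ evalDvd p (2 * s + 1) s a} +
            n * ∑ r : ZMod p, P.real (D r) := by
        rw [integral_add hI hJ, integral_const_mul, integral_const_mul,
          integral_finsetSum _ fun a _ => integrable_indicator_evalDvd hm _ _ _,
          integral_finsetSum _ fun r _ => hDi r]
        simp_rw [integral_indicator_evalDvd hm, integral_indicator_one (hDm _)]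
    _ ≤ p * d * (p ^ (s + 1) * (((p : ℝ) ^ (2 * s + 1 + s))⁻¹ + δ)) + n * (p * β) := by
        have h1 : ∑ a ∈ unitReps p (s + 1),
            P.real {ω | (monicPoly fun i => ξ i ω) ∈ evalDvd p (2 * s + 1) s a} ≤
              p ^ (s + 1) * (((p : ℝ) ^ (2 * s + 1 + s))⁻¹ + δ) := by
          refine (Finset.sum_le_card_nsmul _ _ (((p : ℝ) ^ (2 * s + 1 + s))⁻¹ + δ)
            fun a ha => ?_).trans ?_
          · have h := (abs_le.1 (hδ a (unitReps_isUnit ha) (2 * s + 1) s le_rfl (by omega))).2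
            exact sub_le_iff_le_add'.1 h
          · rw [nsmul_eq_mul]
            refine mul_le_mul_of_nonneg_right ?_ (by positivity)
            have : (unitReps p (s + 1)).card ≤ p ^ (s + 1) :=
              (Finset.card_filter_le _ _).trans (Finset.card_range _).le
            exact_mod_cast this
        have h2 : ∑ r : ZMod p, P.real (D r) ≤ p * β := by
          refine (Finset.sum_le_card_nsmul _ _ β fun r _ => ?_).trans (le_of_eq ?_)
          · rw [hD, measureReal_def, measure_toMeasurable]
            exact hβ r
          · rw [Finset.card_univ, ZMod.card, nsmul_eq_mul]
        gcongr

end Random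

lemma exists_real_class_le (μ : Measure ℤ_[p]) [IsProbabilityMeasure μ]
    (hμ : ∀ a : ZMod p, ¬ ∀ᵐ x ∂μ, PadicInt.toZMod x = a) :
    ∃ α : ℝ, 0 ≤ α ∧ α < 1 ∧ ∀ c : ZMod p, μ.real {x | PadicInt.toZMod x = c} ≤ α := by
  obtain ⟨c, -, hc⟩ := Finset.exists_max_image (Finset.univ : Finset (ZMod p))
    (fun c => μ.real {x | PadicInt.toZMod x = c}) Finset.univ_nonempty
  refine ⟨_, measureReal_nonneg, lt_of_le_of_ne measureReal_le_one fun h => hμ c ?_,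
    fun c' => hc c' (Finset.mem_univ _)⟩
  have hmeas : MeasurableSet {x : ℤ_[p] | PadicInt.toZMod x = c} := measurableSet_toZMod_eq c
  have h1 : μ {x : ℤ_[p] | PadicInt.toZMod x = c} = 1 := by
    rw [measureReal_def] at h
    rwa [← ENNReal.toReal_eq_one_iff]
  exact (mem_ae_iff_prob_eq_one hmeas).2 h1

end

/-! ### The main term and the size of the error -/

/-- Each of the `(p - 1) p ^ l` unit classes modulo `p ^ (l + 1)` contributes to the limit the
probability that a uniform pair `(f(a), f'(a))` satisfies `p ^ (2 l + 1) ∣ f(a)` and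
`p ^ l ∥ f'(a)`. -/
lemma sum_expected_roots {q : ℝ} (hq : 0 < q) (s : ℕ) :
    ∑ l ∈ Finset.range s, (q - 1) * q ^ l * ((q ^ (2 * l + 1 + l))⁻¹ -
      (q ^ (2 * l + 1 + (l + 1)))⁻¹) = (q - 1) / (q + 1) * (1 - (q ^ (2 * s))⁻¹) := by
  induction s with
  | zero => simp
  | succ s ih =>
    rw [Finset.sum_range_succ, ih]
    have h1 : q + 1 ≠ 0 := by positivity
    have h2 : q ≠ 0 := hq.ne'
    rw [show 2 * s + 1 + s = s + 2 * s + 1 by ring, show 2 * s + 1 + (s + 1) = s + 2 * s + 2 by ring,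
      show 2 * (s + 1) = 2 * s + 2 by ring]
    simp only [pow_add]
    field_simp
    ring

/-- With `s` about `log n / (5 log p)` and `d` of order `s`, all error terms are `O(n ^ (-1/4))`. -/
lemma exists_error_bound {p : ℕ} (hp : 2 ≤ p) {α γ : ℝ} (hα0 : 0 ≤ α) (hα : α < 1) (hγ : 0 < γ) :
    ∃ K : ℝ, 0 ≤ K ∧ ∀ n : ℕ, 1 ≤ n → ∃ s d : ℕ,
      ((p : ℝ) ^ (2 * s))⁻¹ +
        2 * p ^ s * Real.exp (-γ / (p : ℝ) ^ (2 * (2 * s + 1))) ^ (n / 2) +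
        p * d * (p ^ (s + 1) * (((p : ℝ) ^ (2 * s + 1 + s))⁻¹ +
          Real.exp (-γ / (p : ℝ) ^ (2 * (2 * s + 1))) ^ (n / 2))) +
        n * (p * α ^ d) ≤ K * (n : ℝ) ^ (-(1 / 4) : ℝ) := by
  have hp2 : (2 : ℝ) ≤ p := by exact_mod_cast hp
  have hp0 : (0 : ℝ) < p := by linarith
  -- `α ^ c < p ^ (-7)` makes `n p α ^ (c (s + 1))` smaller than `p ^ (-2 s)`, since
  -- `n < p ^ (5 s + 5)`
  obtain ⟨c, hc⟩ := exists_pow_lt_of_lt_one (show (0 : ℝ) < ((p : ℝ) ^ 7)⁻¹ by positivity) hα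
  set g := γ / (2 * (p : ℝ) ^ 2) with hg
  have hg0 : 0 < g := by positivity
  set K₁ := Real.exp g * (6 / g ^ 3) with hK₁
  have hK₁0 : 0 < K₁ := by positivity
  set K₂ := 1 + 2 * K₁ + p * c + p ^ 2 * c * K₁ + 1 with hK₂
  have hK₂0 : 0 < K₂ := by positivity
  refine ⟨K₂ * (72 * p ^ 5), by positivity, fun n hn => ⟨Nat.log (p ^ 5) n,
    c * (Nat.log (p ^ 5) n + 1), ?_⟩⟩
  set s := Nat.log (p ^ 5) n with hs
  set Q : ℝ := (p : ℝ) ^ s with hQ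
  have hn0 : (0 : ℝ) < n := by exact_mod_cast hn
  have hQ1 : 1 ≤ Q := one_le_pow₀ (by linarith)
  have hQ0 : 0 < Q := by linarith
  have hlow : Q ^ 5 ≤ n := by
    have := Nat.pow_log_le_self (p ^ 5) (x := n) (by omega)
    rw [hQ, ← pow_mul, mul_comm, pow_mul]
    exact_mod_cast this
  have hup : (n : ℝ) ≤ p ^ 5 * Q ^ 5 := by
    have := (Nat.lt_pow_succ_log_self (b := p ^ 5) (Nat.one_lt_pow (by norm_num) (by omega)) n).le
    rw [hQ, ← pow_mul, mul_comm s 5, pow_mul, ← pow_succ']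
    exact_mod_cast this
  set δ := Real.exp (-γ / (p : ℝ) ^ (2 * (2 * s + 1))) ^ (n / 2) with hδ
  have hδ0 : 0 < δ := by positivity
  -- the exponent is at most `- g (Q - 1)`, because `n ≥ Q ^ 5` while `γ` is divided by `p ^ 2 Q ^ 4`
  have hδ3 : δ ≤ K₁ * (Q ^ 3)⁻¹ := by
    have e1 : δ ≤ Real.exp (g - g * Q) := by
      rw [hδ, ← Real.exp_nat_mul]
      apply Real.exp_le_exp.2
      have h2 : ((n : ℝ) - 1) / 2 ≤ ((n / 2 : ℕ) : ℝ) := by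
        have : n ≤ 2 * (n / 2) + 1 := by omega
        have : (n : ℝ) ≤ 2 * ((n / 2 : ℕ) : ℝ) + 1 := by exact_mod_cast this
        linarith
      have h3 : (p : ℝ) ^ (2 * (2 * s + 1)) = p ^ 2 * Q ^ 4 := by rw [hQ]; ring
      have h4 : g * (Q - 1) * Q ^ 4 ≤ g * (n - 1) := by
        rw [mul_assoc]
        refine mul_le_mul_of_nonneg_left ?_ hg0.le
        nlinarith [one_le_pow₀ (n := 4) hQ1]
      have h5 : γ = g * (2 * p ^ 2) := by rw [hg]; field_simp
      rw [h3]
      have h6 : g * (Q - 1) ≤ ((n / 2 : ℕ) : ℝ) * (γ / (p ^ 2 * Q ^ 4)) := by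
        have h7 : ((n : ℝ) - 1) / 2 * (γ / (p ^ 2 * Q ^ 4)) ≤
            ((n / 2 : ℕ) : ℝ) * (γ / (p ^ 2 * Q ^ 4)) :=
          mul_le_mul_of_nonneg_right h2 (by positivity)
        refine le_trans ?_ h7
        have h8 : ((n : ℝ) - 1) / 2 * (γ / (p ^ 2 * Q ^ 4)) = g * (n - 1) / Q ^ 4 := by
          rw [h5]; field_simp
        rw [h8, le_div_iff₀ (by positivity)]
        exact h4
      rw [neg_div, mul_neg]
      linarith
    have e2 : Real.exp (g - g * Q) ≤ K₁ * (Q ^ 3)⁻¹ := by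
      rw [sub_eq_add_neg, Real.exp_add, hK₁, mul_assoc]
      refine mul_le_mul_of_nonneg_left ?_ (Real.exp_pos _).le
      have h1 := Real.pow_div_factorial_le_exp (g * Q) (by positivity) 3
      rw [Real.exp_neg, show 6 / g ^ 3 * (Q ^ 3)⁻¹ = ((g * Q) ^ 3 / 6)⁻¹ by
        rw [mul_pow]; field_simp]
      refine inv_anti₀ (by positivity) ?_
      simpa [Nat.factorial] using h1
    exact e1.trans e2
  have hs1 : (1 : ℝ) ≤ s + 1 := by have : (0 : ℝ) ≤ s := Nat.cast_nonneg _; linarith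
  set y := (Q ^ 2)⁻¹ with hy
  have hy0 : 0 < y := by positivity
  have hQδ : Q * δ ≤ K₁ * y := by
    calc Q * δ ≤ Q * (K₁ * (Q ^ 3)⁻¹) := mul_le_mul_of_nonneg_left hδ3 hQ0.le
      _ = K₁ * y := by rw [hy]; field_simp
  have hα' : (n : ℝ) * (p * α ^ (c * (s + 1))) ≤ y := by
    have h1 : α ^ (c * (s + 1)) ≤ ((p : ℝ) ^ 7 * Q ^ 7)⁻¹ := by
      rw [pow_mul]
      refine (pow_le_pow_left₀ (by positivity) hc.le _).trans (le_of_eq ?_)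
      rw [hQ, inv_pow]
      congr 1
      ring
    calc (n : ℝ) * (p * α ^ (c * (s + 1)))
        ≤ (p ^ 5 * Q ^ 5) * (p * ((p : ℝ) ^ 7 * Q ^ 7)⁻¹) := by gcongr
      _ = y * (p : ℝ)⁻¹ := by rw [hy]; field_simp
      _ ≤ y := mul_le_of_le_one_right hy0.le (inv_le_one_of_one_le₀ (by linarith))
  have hmain : ((p : ℝ) ^ (2 * s))⁻¹ + 2 * p ^ s * δ +
        p * (c * (s + 1) : ℕ) * (p ^ (s + 1) * (((p : ℝ) ^ (2 * s + 1 + s))⁻¹ + δ)) +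
        n * (p * α ^ (c * (s + 1))) ≤ K₂ * ((s + 1) * y) := by
    have e1 : ((p : ℝ) ^ (2 * s))⁻¹ = y := by rw [hy, hQ]; congr 1; ring
    have e2 : (p : ℝ) ^ (s + 1) * (((p : ℝ) ^ (2 * s + 1 + s))⁻¹ + δ) = y + p * (Q * δ) := by
      rw [mul_add, hy, show (p : ℝ) ^ (2 * s + 1 + s) = p ^ (s + 1) * Q ^ 2 by rw [hQ]; ring,
        mul_inv, ← mul_assoc, mul_inv_cancel₀ (by positivity), one_mul, hQ]
      ring
    rw [e1, e2, mul_assoc 2, ← hQ]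
    push_cast
    have e3 : y ≤ (s + 1) * y := le_mul_of_one_le_left hy0.le hs1
    have e4 : p * (c * ((s : ℝ) + 1)) * (y + p * (Q * δ)) ≤
        p * (c * ((s : ℝ) + 1)) * (y + p * (K₁ * y)) := by gcongr
    have e5 : K₁ * y ≤ K₁ * ((s + 1) * y) := mul_le_mul_of_nonneg_left e3 hK₁0.le
    have e6 : K₂ * ((s + 1) * y) = (s + 1) * y + 2 * (K₁ * ((s + 1) * y)) +
        p * (c * ((s : ℝ) + 1)) * (y + p * (K₁ * y)) + (s + 1) * y := by rw [hK₂]; ring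
    rw [e6]
    linarith
  refine hmain.trans ?_
  rw [mul_assoc]
  refine mul_le_mul_of_nonneg_left ?_ hK₂0.le
  -- the fourth power of the claim, where `n ≤ p ^ 5 Q ^ 5` leaves a factor `(s + 1) ^ 4 / Q ^ 3`
  have hs4 : ((s : ℝ) + 1) ^ 4 ≤ 72 * Q ^ 3 := by
    have h1 := Real.pow_div_factorial_le_exp ((s : ℝ) + 1) (by positivity) 4
    have h2 : Real.exp ((s : ℝ) + 1) ≤ 3 * 8 ^ s := by
      rw [Real.exp_add, ← mul_one (s : ℝ), Real.exp_nat_mul, mul_comm (3 : ℝ)]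
      have h3 := Real.exp_one_lt_d9
      gcongr <;> linarith
    have h3 : (8 : ℝ) ^ s ≤ Q ^ 3 := by
      rw [hQ, ← pow_mul, mul_comm, pow_mul]
      refine pow_le_pow_left₀ (by norm_num) ?_ _
      calc (8 : ℝ) = 2 ^ 3 := by norm_num
        _ ≤ _ := by gcongr
    have h4 : ((Nat.factorial 4 : ℕ) : ℝ) = 24 := by norm_num [Nat.factorial]
    rw [h4, div_le_iff₀ (by norm_num)] at h1
    linarith
  have hM : (1 : ℝ) ≤ 72 * p ^ 5 := by
    have : (1 : ℝ) ≤ p ^ 5 := one_le_pow₀ (by linarith)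
    linarith
  have hrp : ((n : ℝ) ^ (-(1 / 4) : ℝ)) ^ 4 = (n : ℝ)⁻¹ := by
    rw [← Real.rpow_mul_natCast hn0.le, ← Real.rpow_neg_one]
    norm_num
  have h4 : ((s + 1) * y) ^ 4 ≤ (72 * p ^ 5 * (n : ℝ) ^ (-(1 / 4) : ℝ)) ^ 4 := by
    rw [mul_pow _ ((n : ℝ) ^ _), hrp]
    calc ((s + 1) * y) ^ 4 = ((s : ℝ) + 1) ^ 4 * (Q ^ 8)⁻¹ := by rw [mul_pow, hy]; ring
      _ ≤ 72 * Q ^ 3 * (Q ^ 8)⁻¹ := by gcongr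
      _ = 72 * p ^ 5 * (p ^ 5 * Q ^ 5)⁻¹ := by field_simp
      _ ≤ 72 * p ^ 5 * (n : ℝ)⁻¹ := by gcongr
      _ ≤ (72 * p ^ 5) ^ 4 * (n : ℝ)⁻¹ := by
        gcongr
        exact le_self_pow₀ hM (by norm_num)
  exact le_of_pow_le_pow_left₀ (by norm_num) (by positivity) h4

/-! ### Conclusion -/

theorem theorem1p1 (p : ℕ) [Fact p.Prime] [MeasurableSpace ℤ_[p]] [BorelSpace ℤ_[p]]
    (μ : Measure ℤ_[p]) [IsProbabilityMeasure μ]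
    (hμ : ∀ a : ZMod p, ¬ ∀ᵐ x ∂μ, PadicInt.toZMod x = a)
    (ε : ℝ) (hε : 0 < ε) :
    ∃ K : ℝ, ∀ n : ℕ, 1 ≤ n →
      ∀ (Ω : Type*) [MeasurableSpace Ω] (P : Measure Ω) [IsProbabilityMeasure P]
        (ξ : Fin n → Ω → ℤ_[p]),
        (∀ i, Measurable (ξ i)) → iIndepFun ξ P → (∀ i, P.map (ξ i) = μ) →
        Integrable (fun ω => (rootCount ℚ_[p] (monicPoly fun i => ξ i ω) : ℝ)) P ∧
        Integrable (fun ω =>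
          (rootCount ℤ_[p] ((monicPoly fun i => ξ i ω).comp (C (p : ℤ_[p]) * X)) : ℝ)) P ∧
        |(∫ ω, (rootCount ℚ_[p] (monicPoly fun i => ξ i ω) : ℝ) ∂P) -
            ((∫ ω, (rootCount ℤ_[p]
                ((monicPoly fun i => ξ i ω).comp (C (p : ℤ_[p]) * X)) : ℝ) ∂P) +
              ((p : ℝ) - 1) / ((p : ℝ) + 1))| ≤
          K * (n : ℝ) ^ (-(1 / 4 : ℝ) + ε) := by
  have hp2 : 2 ≤ p := (Fact.out : p.Prime).two_le
  have hp0 : (0 : ℝ) < p := by positivity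
  obtain ⟨α, hα0, hα1, hα⟩ := exists_real_class_le μ hμ
  obtain ⟨γ, hγ0, hγ⟩ := exists_norm_integral_char_le μ hμ
  obtain ⟨K, hK0, hK⟩ := exists_error_bound hp2 hα0 hα1 hγ0
  refine ⟨K, fun n hn Ω _ P _ ξ hm hi hl => ?_⟩
  have hIU : Integrable (fun ω =>
      ({x : ℤ_[p] | (monicPoly fun i => ξ i ω).eval x = 0 ∧ IsUnit x}.ncard : ℝ)) P :=
    integrable_ncard_roots hm isClosed_isUnit
  have hI0 : Integrable (fun ω =>
      (rootCount ℤ_[p] ((monicPoly fun i => ξ i ω).comp (C (p : ℤ_[p]) * X)) : ℝ)) P := by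
    simp_rw [rootCount_comp_eq]
    exact integrable_ncard_roots hm isClosed_not_isUnit
  have hadd : (fun ω => (rootCount ℚ_[p] (monicPoly fun i => ξ i ω) : ℝ)) = fun ω =>
      (rootCount ℤ_[p] ((monicPoly fun i => ξ i ω).comp (C (p : ℤ_[p]) * X)) : ℝ) +
      ({x : ℤ_[p] | (monicPoly fun i => ξ i ω).eval x = 0 ∧ IsUnit x}.ncard : ℝ) := by
    ext ω
    rw [rootCount_padic_eq_add (monic_monicPoly _), Nat.cast_add]
  rw [hadd]
  refine ⟨hI0.add hIU, hI0, ?_⟩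
  rw [integral_add hI0 hIU, add_sub_add_left_eq_sub]
  obtain ⟨s, d, hsd⟩ := hK n hn
  set δ := Real.exp (-γ / (p : ℝ) ^ (2 * (2 * s + 1))) ^ (n / 2) with hδ_def
  have hδ : ∀ x : ℤ_[p], IsUnit x → ∀ i j : ℕ, i ≤ 2 * s + 1 → j ≤ 2 * s + 1 →
      |P.real {ω | (p : ℤ_[p]) ^ i ∣ (monicPoly fun i => ξ i ω).eval x ∧
        (p : ℤ_[p]) ^ j ∣ (derivative (monicPoly fun i => ξ i ω)).eval x} -
      ((p : ℝ) ^ (i + j))⁻¹| ≤ δ := fun x hx i j hi' hj' =>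
    abs_prob_pow_dvd_sub_le hm hi hl (fun η => hγ η _) hx hi' hj'
  have h1 := abs_integral_simpleCount_sub_le hm hδ
  have h2 := integral_degenerate_le hm hδ (prob_pow_dvd_map_le hm hi hl hα · d)
  rw [sum_expected_roots hp0] at h1
  set S := ∫ ω, simpleCount s (monicPoly fun i => ξ i ω) ∂P
  set W := ∫ ω, ({x : ℤ_[p] | ((monicPoly fun i => ξ i ω).eval x = 0 ∧ IsUnit x) ∧
    (p : ℤ_[p]) ^ s ∣ (derivative (monicPoly fun i => ξ i ω)).eval x}.ncard : ℝ) ∂P with hW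
  have hW0 : 0 ≤ W := integral_nonneg fun ω => Nat.cast_nonneg _
  have hSW : ∫ ω, ({x : ℤ_[p] |
      (monicPoly fun i => ξ i ω).eval x = 0 ∧ IsUnit x}.ncard : ℝ) ∂P = S + W := by
    rw [← sub_eq_iff_eq_add', ← integral_sub hIU (integrable_simpleCount hm s), hW]
    congr 1
    ext ω
    rw [ncard_unitRoots_eq _ (monic_monicPoly _).ne_zero s, add_sub_cancel_left]
  have hq : |((p : ℝ) - 1) / (p + 1) * ((p : ℝ) ^ (2 * s))⁻¹| ≤ ((p : ℝ) ^ (2 * s))⁻¹ := by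
    have hp1 : (1 : ℝ) ≤ p := by exact_mod_cast (by omega : 1 ≤ p)
    have h0 : 0 ≤ ((p : ℝ) - 1) / (p + 1) := div_nonneg (by linarith) (by linarith)
    rw [abs_of_nonneg (by positivity)]
    refine mul_le_of_le_one_left (by positivity) ?_
    rw [div_le_one (by linarith)]
    linarith
  have hn1 : (1 : ℝ) ≤ n := by exact_mod_cast hn
  calc _ = |(S - ((p : ℝ) - 1) / (p + 1) * (1 - ((p : ℝ) ^ (2 * s))⁻¹)) + W -
        ((p : ℝ) - 1) / (p + 1) * ((p : ℝ) ^ (2 * s))⁻¹| := by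
        rw [hSW]; congr 1; ring
    _ ≤ K * (n : ℝ) ^ (-(1 / 4) : ℝ) := by
        refine le_trans ?_ hsd
        rw [abs_le] at h1 hq ⊢
        constructor <;> linarith [h1.1, h1.2, hq.1, hq.2]
    _ ≤ K * (n : ℝ) ^ (-(1 / 4 : ℝ) + ε) :=
        mul_le_mul_of_nonneg_left (Real.rpow_le_rpow_of_exponent_le hn1 (by linarith)) hK0
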